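/- Let $\mathbb C^{2,1}$ be $\mathbb C^3$ with the Hermitian form $\langle X,Y\rangle = X_1\bar Y_3+X_2\bar Y_2+X_3\bar Y_1$. Let $\mathbf H^2_{\mathbb C}\subset\mathbb CP^2$ be the complex hyperbolic plane (the projectivised negative cone, with distance $d$ given by $\cosh^2\frac{d(m,n)}2=\frac{\langle \mathbf m,\mathbf n\rangle\langle \mathbf n,\mathbf m\rangle}{\langle \mathbf m,\mathbf m\rangle\langle \mathbf n,\mathbf n\rangle}$ for lifts $\mathbf m,\mathbf n$ of $m,n$) and $\partial\mathbf H^2_{\mathbb C}$ its boundary (the projectivised null cone). A real plane is a non-empty intersection with $\mathbf H^2_{\mathbb C}$ of the projectivisation of a Lagrangian subspace of $\mathbb C^{2,1}$; the real symmetry about it is the antiholomorphic isometric involution, acting also on $\partial\mathbf H^2_{\mathbb C}$, whose fixed point set in $\mathbf H^2_{\mathbb C}$ (its mirror) is that plane. A real ideal triangle is a triple of distinct points of $\partial\mathbf H^2_{\mathbb C}$ lying in the boundary of a real plane. For real ideal triangles $\tau=(a,b,c)$ and $\tau'=(a,c,d)$ sharing the edge $ac$, with $d\neq b$, $\mathtt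 Z(\tau,\tau')$ is the unique $z\in\mathbb C\setminus\{0,-1\}$ such that some element of $\mathrm{PU}(2,1)$ maps $(a,b,c,d)$ to $(\infty,[-1,0],[0,0],[z,0])$, where $\infty$ has lift $(1,0,0)$ and $[w,t]$ has lift $(-|w|^2+it,\,w\sqrt2,\,1)$. (Exchanging the roles of $a$ and $c$ changes $z$ into $1/\bar z$ and does not change its argument.) If $\arg\mathtt Z(\tau,\tau')\neq\pi$, the splitting surface $\mathrm{Spl}(\tau,\tau')$ is the unique set of the form $\Pi_P^{-1}(\gamma)\subset\mathbf H^2_{\mathbb C}$, where $\gamma$ is the geodesic with endpoints $a,c$, $P$ is a real plane containing $\gamma$ and $\Pi_P:\mathbf H^2_{\mathbb C}\to P$ is the orthogonal projection, such that one of the fibres $\Pi_P^{-1}(x)$, $x\in\gamma$, is the mirror of the unique real symmetry mapping $a$ to $c$ and $b$ to $d$. **Theorem.** Let $\tau$ be a real ideal triangle with vertices $(p_1,p_2,p_3)$. For $i=1,2,3$ (indices mod 3) let $\tau_i$ be a real ideal triangle adjacent to $\tau$ along the geodesic $\gamma_i$ with endpoints $p_{i+1},p_{i+2}$. Suppose that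 there is $\theta\in[-\pi/2,\pi/2]$ such that $\arg \mathtt Z(\tau,\tau_i)=\theta$ for $i=1,2,3$. Then the three splitting surfaces $S_i=\mathrm{Spl}(\tau,\tau_i)$ satisfy, for $i=1,2,3$: 1. $S_i\cap S_{i+1}=\emptyset$ in $\mathbf H^2_{\mathbb C}$; 2. the closures of $S_i$ and $S_{i+1}$ in $\mathbf H^2_{\mathbb C}\cup\partial\mathbf H^2_{\mathbb C}$ intersect exactly in $\{p_{i+2}\}$. -/

import Mathlib

namespace CHyp

open scoped ComplexConjugate

/-- The vector space `ℂ³` underlying `ℂ^{2,1}`. -/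
abbrev C3 : Type := Fin 3 → ℂ

/-- The complex projective plane. -/
abbrev CP2 : Type := Projectivization ℂ C3

/-- The quotient topology on the complex projective plane, coming from `ℂ³ ∖ {0}`. -/
noncomputable instance instTopologicalSpaceCP2 : TopologicalSpace CP2 :=
  TopologicalSpace.coinduced (Projectivization.mk' ℂ : {v : C3 // v ≠ 0} → CP2) inferInstance

/-- The Hermitian form of signature `(2,1)`, i.e. `⟨X, Y⟩ = Xᵀ J Ȳ` where `J` is the
antidiagonal matrix with entries `1`. -/
noncomputable def herm (X Y : C3) : ℂ :=
  X 0 * conj (Y 2) + X 1 * conj (Y 1) + X 2 * conj (Y 0)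

/-- The nonzero vector `v` is a lift to `ℂ³` of the point `m` of the projective plane. -/
def IsLift (v : C3) (m : CP2) : Prop :=
  ∃ hv : v ≠ 0, Projectivization.mk ℂ v hv = m

/-- The complex hyperbolic plane: the projectivisation of the negative cone. -/
noncomputable def H2C : Set CP2 := {m | (herm m.rep m.rep).re < 0}

/-- The boundary at infinity: the projectivisation of the null cone. -/
noncomputable def boundary : Set CP2 := {m | herm m.rep m.rep = 0}

/-- The complex hyperbolic distance `d`, characterised by
`cosh² (d(m,n)/2) = ⟨m,n⟩⟨n,m⟩ / (⟨m,m⟩⟨n,n⟩)` for `m`, `n` in the complex hyperbolic plane. -/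
noncomputable def hdist (m n : CP2) : ℝ :=
  2 * Real.arcosh (Real.sqrt
    ((herm m.rep n.rep * herm n.rep m.rep) / (herm m.rep m.rep * herm n.rep n.rep)).re)

/-- The closure of a set `S` in the union of the complex hyperbolic plane and its boundary
(with the topology induced by the projective plane). -/
def closureBar (S : Set CP2) : Set CP2 := closure S ∩ (H2C ∪ boundary)

/-- A real plane, given by a Lagrangian subspace of `ℂ^{2,1}` (a real subspace of dimension 3 on
which the Hermitian form is real) whose projectivisation meets the complex hyperbolic plane. -/
structure RealPlane where
  lag : Submodule ℝ C3
  finrank_lag : Module.finrank ℝ lag = 3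
  im_herm : ∀ v ∈ lag, ∀ w ∈ lag, (herm v w).im = 0
  exists_neg : ∃ v ∈ lag, (herm v v).re < 0

/-- The points of a real plane in the complex hyperbolic plane. -/
def RealPlane.points (P : RealPlane) : Set CP2 :=
  {m | m ∈ H2C ∧ ∃ v ∈ P.lag, IsLift v m}

/-- The boundary at infinity of a real plane. -/
def RealPlane.bdry (P : RealPlane) : Set CP2 :=
  {m | m ∈ boundary ∧ ∃ v ∈ P.lag, IsLift v m}

/-- The real symmetry about the real plane `P` maps `m` to `n`. This symmetry is induced by the
conjugation of `ℂ³ = L ⊕ iL` with respect to the Lagrangian `L` of `P`. -/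
def RealPlane.SymmMaps (P : RealPlane) (m n : CP2) : Prop :=
  ∃ x ∈ P.lag, ∃ y ∈ P.lag,
    IsLift (x + Complex.I • y) m ∧ IsLift (x - Complex.I • y) n

/-- The geodesic of the complex hyperbolic plane with endpoints `a`, `b` on the boundary: the set
of all `[v + w]` where `v`, `w` are lifts of `a`, `b` such that `⟨v, w⟩` is a negative real. -/
def geodesic (a b : CP2) : Set CP2 :=
  {m | ∃ v w : C3, IsLift v a ∧ IsLift w b ∧
    (herm v w).re < 0 ∧ (herm v w).im = 0 ∧ IsLift (v + w) m}

/-- The fibre over `x` of the orthogonal projection onto the real plane `P`, i.e. the set of the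
points `m` of the complex hyperbolic plane whose nearest point in `P` is `x`. -/
def RealPlane.fibre (P : RealPlane) (x : CP2) : Set CP2 :=
  {m | m ∈ H2C ∧ x ∈ P.points ∧ ∀ y ∈ P.points, hdist m x ≤ hdist m y}

/-- The spinal `ℝ`-surface with respect to `P` built on a geodesic `γ` contained in `P`: the inverse
image of `γ` under the orthogonal projection onto `P`. Its leaves are the fibres over the points
of `γ`. -/
def RealPlane.spinal (P : RealPlane) (γ : Set CP2) : Set CP2 :=
  {m | ∃ x ∈ γ, m ∈ P.fibre x}

/-- `(a, b, c)` is a real ideal triangle: three distinct points in the boundary of a real plane. -/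
def IsRealIdealTriangle (a b c : CP2) : Prop :=
  a ≠ b ∧ b ≠ c ∧ a ≠ c ∧ ∃ P : RealPlane, a ∈ P.bdry ∧ b ∈ P.bdry ∧ c ∈ P.bdry

/-- The lift of the boundary point with Heisenberg coordinates `[z, t]`. -/
noncomputable def heisLift (z : ℂ) (t : ℝ) : C3 :=
  ![-((‖z‖ ^ 2 : ℝ) : ℂ) + (t : ℂ) * Complex.I, z * ((Real.sqrt 2 : ℝ) : ℂ), 1]

theorem heisLift_ne_zero (z : ℂ) (t : ℝ) : heisLift z t ≠ 0 := by
  intro h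
  have := congrFun h 2
  simp [heisLift] at this

/-- The boundary point with Heisenberg coordinates `[z, t]`. -/
noncomputable def heis (z : ℂ) (t : ℝ) : CP2 :=
  Projectivization.mk ℂ (heisLift z t) (heisLift_ne_zero z t)

theorem inftyLift_ne_zero : (![1, 0, 0] : C3) ≠ 0 := by
  intro h
  have := congrFun h 0
  simp at this

/-- The boundary point `∞`. -/
noncomputable def infty : CP2 := Projectivization.mk ℂ ![1, 0, 0] inftyLift_ne_zero

/-- The linear automorphism `A` is unitary for the Hermitian form, i.e. belongs to `U(2,1)`. -/
def IsUnitary (A : C3 ≃ₗ[ℂ] C3) : Prop := ∀ v w : C3, herm (A v) (A w) = herm v w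

/-- The action of a linear automorphism on the projective plane. -/
noncomputable def act (A : C3 ≃ₗ[ℂ] C3) : CP2 → CP2 :=
  Projectivization.map (A : C3 →ₗ[ℂ] C3) A.injective

/-- The ordered pair of triangles `(a, b, c)`, `(a, c, d)` is equivalent under `PU(2,1)` to the
reference pair `(∞, [-1,0], [0,0])`, `(∞, [0,0], [z,0])`. -/
def HasInvariant (a b c d : CP2) (z : ℂ) : Prop :=
  ∃ A : C3 ≃ₗ[ℂ] C3, IsUnitary A ∧
    act A a = infty ∧ act A b = heis (-1) 0 ∧ act A c = heis 0 0 ∧ act A d = heis z 0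

/-- The invariant `Z(τ, τ')` of the pair of adjacent real ideal triangles `τ = (a, b, c)`,
`τ' = (a, c, d)`: the unique `z` such that the pair is equivalent to the reference pair. -/
noncomputable def Z (a b c d : CP2) : ℂ := Classical.epsilon (HasInvariant a b c d)

/-- `Q` is the mirror of the symmetry of the pair of adjacent real ideal triangles
`τ = (a, b, c)`, `τ' = (a, c, d)`, i.e. of the real symmetry mapping `a` to `c` and `b` to `d`. -/
def IsMirrorOfPair (a b c d : CP2) (Q : RealPlane) : Prop :=
  Q.SymmMaps a c ∧ Q.SymmMaps b d

/-- `S` is a spinal `ℝ`-surface built on the common geodesic of `τ = (a, b, c)`,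
`τ' = (a, c, d)`, and the mirror of the symmetry of the pair is one of its leaves. -/
def IsSplittingSurface (a b c d : CP2) (S : Set CP2) : Prop :=
  ∃ P Q : RealPlane, geodesic a c ⊆ P.points ∧ S = P.spinal (geodesic a c) ∧
    IsMirrorOfPair a b c d Q ∧ ∃ x ∈ geodesic a c, P.fibre x = Q.points

/-- The splitting surface `Spl(τ, τ')` of the adjacent real ideal triangles `τ = (a, b, c)`,
`τ' = (a, c, d)`: the unique spinal `ℝ`-surface built on the common geodesic that has the mirror
of the symmetry of the pair as one of its leaves. -/
noncomputable def Spl (a b c d : CP2) : Set CP2 := Classical.epsilon (IsSplittingSurface a b c d)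

end CHyp

/-!
Every splitting surface lies on an explicit real hypersurface, and the three hypersurfaces have the
same shape in coordinates adapted to the triangle `τ`, so the theorem becomes an inequality between
complex numbers.

*Equation of a splitting surface.* In the reference position, `a = ∞`, `b = [-1, 0]`, `c = [0, 0]`,
`d = [z, 0]`. A real plane containing the geodesic `γ` from `∞` to `[0, 0]` is given, up to a scalar,
by the real span of `e₀`, `u e₁`, `e₂` with `|u| = 1` (`exists_isStdPlane`). The first order
conditions for the nearest point show that its spinal surface over `γ` lies in
`{[v] | conj u² v₁² conj (v₀ v₂) ∈ ℝ≥0}` (`isNonneg_of_fibre_conditions`). The mirror of the pair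
lies in the analogous set with `conj u²` replaced by `conj z` (`mirror_equation`); being a leaf, it
forces `u² = ω := z / |z|`. Conversely, the real plane with `u² = ω` does have the mirror as a fibre
(`fibre_eq_stdMirror`), so splitting surfaces exist. As `Z` exists too (`exists_hasInvariant`),
`Spl` has these properties in general position (`Spl_subset`).

*Comparison.* The vertices of `τ` have lifts `u₀`, `u₁`, `u₂` with mutual products `-1`, unique up
to a common unit scalar. With `Xⱼ = ⟨v, uⱼ⟩`, the surface `Sᵢ` satisfies
`-conj ω (Xᵢ - Xᵢ₊₁ - Xᵢ₊₂)² conj (Xᵢ₊₁ Xᵢ₊₂) ∈ ℝ≥0`, which is a closed condition, and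
`2⟨v, v⟩ = ∑ |Xⱼ|² - 2 Re ∑ Xⱼ conj Xⱼ₊₁`. If `⟨v, v⟩ ≤ 0` and `Re ω = cos θ ≥ 0`, two consecutive
conditions force `Xᵢ₊₂ = 0` (`eq_zero_of_splitting`, which rests on `core_bound`). A negative or
null vector orthogonal to the null vector `uᵢ₊₂` is proportional to it, so the closures meet at most
in `pᵢ₊₂`; this vertex is an endpoint of the geodesics contained in both surfaces.
-/

namespace CHyp

open scoped ComplexConjugate

/-! ### The inequality between complex numbers -/


/-- The key estimate in real coordinates `D = a + b i`, `ω = c + e i`. The equations say that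
`m (D² + 1) = (ω + 2 s) D`, and the conclusion bounds from below the real part of
`(s + 2 (s² - m²) conj ω) D`. Only the term in `e b` can be negative, when `|D| < 1`; it is then
controlled by eliminating `s` with the first equation and by `|e| ≤ 1`. -/
theorem core_bound_real {a b c e m s : ℝ} (hc : 0 ≤ c) (he : c ^ 2 + e ^ 2 = 1)
    (hm : 0 < m) (hms : m ≤ s) (hN : 0 < a ^ 2 + b ^ 2)
    (h1 : m * a * (a ^ 2 + b ^ 2 + 1) = (c + 2 * s) * (a ^ 2 + b ^ 2))
    (h2 : m * b * (a ^ 2 + b ^ 2 - 1) = e * (a ^ 2 + b ^ 2)) :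
    0 < s * a + 2 * (s ^ 2 - m ^ 2) * (c * a + e * b) + m * (1 + (a ^ 2 + b ^ 2)) / 2 := by
  have hNab : a ^ 2 = (a ^ 2 + b ^ 2) - b ^ 2 := by ring
  generalize a ^ 2 + b ^ 2 = N at *
  have hs : 0 < s := hm.trans_le hms
  have ha : 0 < a := by
    have : 0 < m * a * (N + 1) := by rw [h1]; positivity
    have h3 := pos_of_mul_pos_left this (by positivity)
    exact pos_of_mul_pos_right h3 hm.le
  have hsm : 0 ≤ s ^ 2 - m ^ 2 := by nlinarith
  have hca : 0 ≤ c * a := by positivity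
  -- `e b = m b² (N - 1) / N`
  have heb : e * b = m * b ^ 2 * (N - 1) / N := by
    field_simp; linear_combination -b * h2
  rcases le_or_gt 1 N with h | h
  · have : 0 ≤ e * b := by
      rw [heb]; have : 0 ≤ N - 1 := by linarith
      positivity
    positivity
  · have hs2 : 2 * s * N ≤ m * a * (N + 1) := by rw [h1]; nlinarith
    have hb1 : 4 * (s ^ 2 - m ^ 2) * N ^ 2 ≤ m ^ 2 * (1 - N) ^ 2 * a ^ 2 := by
      have h5 : (2 * s * N) ^ 2 ≤ (m * a * (N + 1)) ^ 2 := by gcongr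
      have h6 : m ^ 2 * a ^ 2 * N ≤ m ^ 2 * N * N := by
        have : a ^ 2 ≤ N := by nlinarith [sq_nonneg b]
        nlinarith [mul_le_mul_of_nonneg_left this (by positivity : 0 ≤ m ^ 2 * N)]
      nlinarith
    have hb2 : m ^ 2 * b ^ 2 * (1 - N) ^ 2 ≤ N ^ 2 := by
      have : (m * b * (N - 1)) ^ 2 = e ^ 2 * N ^ 2 := by rw [h2]; ring
      have : e ^ 2 * N ^ 2 ≤ 1 * N ^ 2 := by gcongr; nlinarith [sq_nonneg c]
      nlinarith
    have haN : a ^ 2 ≤ N := by nlinarith [sq_nonneg b]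
    -- the negative contribution is bounded by `m (1 - N) / 2`
    have hkey : 2 * (s ^ 2 - m ^ 2) * (m * b ^ 2 * (1 - N) / N) ≤ m * (1 - N) / 2 := by
      rw [mul_div_assoc', div_le_div_iff₀ hN two_pos]
      have h7 : 4 * (s ^ 2 - m ^ 2) * b ^ 2 * N ^ 2 ≤ N ^ 3 := by
        calc 4 * (s ^ 2 - m ^ 2) * b ^ 2 * N ^ 2
            = (4 * (s ^ 2 - m ^ 2) * N ^ 2) * b ^ 2 := by ring
          _ ≤ (m ^ 2 * (1 - N) ^ 2 * a ^ 2) * b ^ 2 := by gcongr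
          _ = (m ^ 2 * b ^ 2 * (1 - N) ^ 2) * a ^ 2 := by ring
          _ ≤ N ^ 2 * N := by gcongr
          _ = N ^ 3 := by ring
      have h8 : 4 * (s ^ 2 - m ^ 2) * b ^ 2 ≤ N := by
        have : (4 * (s ^ 2 - m ^ 2) * b ^ 2) * N ^ 2 ≤ N * N ^ 2 := by linarith [h7]
        exact le_of_mul_le_mul_right this (by positivity)
      have : 0 ≤ m * (1 - N) := mul_nonneg hm.le (by linarith)
      nlinarith
    have h9 : e * b = -(m * b ^ 2 * (1 - N) / N) := by rw [heb]; ring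
    rw [h9]
    have : 0 < s * a := by positivity
    have : 0 ≤ 2 * (s ^ 2 - m ^ 2) * (c * a) := by positivity
    have : 0 < m * N := by positivity
    nlinarith

/-- The estimate `core_bound` when `q < p`: with `m = p - q` and `s = p + q`, multiply the
conclusion by `m` and use the hypothesis to reduce to `core_bound_real`. -/
theorem core_bound_of_lt {ω D : ℂ} {p q : ℝ} (hω : ‖ω‖ = 1) (hre : 0 ≤ ω.re) (hq : 0 < q)
    (hpq : q < p) (hD : D ≠ 0) (h : ω * D = p * (D - 1) ^ 2 - q * (D + 1) ^ 2) :
    0 < (conj ω * (p * (D - 1) ^ 2 + q * (D + 1) ^ 2)).re + (1 + ‖D‖ ^ 2) / 2 := by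
  have hn : ω.re ^ 2 + ω.im ^ 2 = 1 := by
    have := Complex.sq_norm ω; rw [hω, Complex.normSq_apply] at this; linarith
  have hN : 0 < D.re ^ 2 + D.im ^ 2 := by
    have := Complex.normSq_pos.2 hD
    rw [Complex.normSq_apply] at this; linarith
  have hr := congrArg Complex.re h
  have hi := congrArg Complex.im h
  simp [pow_two] at hr hi
  have hm : 0 < p - q := by linarith
  have h1 : (p - q) * D.re * (D.re ^ 2 + D.im ^ 2 + 1)
      = (ω.re + 2 * (p + q)) * (D.re ^ 2 + D.im ^ 2) := by
    linear_combination -D.re * hr - D.im * hi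
  have h2 : (p - q) * D.im * (D.re ^ 2 + D.im ^ 2 - 1) = ω.im * (D.re ^ 2 + D.im ^ 2) := by
    linear_combination -D.re * hi + D.im * hr
  have := core_bound_real hre hn hm (by linarith : p - q ≤ p + q) hN h1 h2
  have key : (p - q) * ((conj ω * (p * (D - 1) ^ 2 + q * (D + 1) ^ 2)).re + (1 + ‖D‖ ^ 2) / 2)
      = (p + q) * D.re + 2 * ((p + q) ^ 2 - (p - q) ^ 2) * (ω.re * D.re + ω.im * D.im)
        + (p - q) * (1 + (D.re ^ 2 + D.im ^ 2)) / 2 := by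
    rw [Complex.sq_norm, Complex.normSq_apply]
    simp [pow_two]
    linear_combination (-(p + q) * ω.re) * hr + (-(p + q) * ω.im) * hi + (p + q) * D.re * hn
  rw [← key] at this
  exact pos_of_mul_pos_right this hm.le

/-- If `|ω| = 1`, `Re ω ≥ 0` and `ω D = p (D - 1)² - q (D + 1)²` with `p, q > 0`, then
`- conj ω (p (D - 1)² + q (D + 1)²)` has real part less than `(1 + |D|²) / 2`. The symmetry
`(p, q, D) ↦ (q, p, -D)` allows to assume `q < p`. -/
theorem core_bound {ω D : ℂ} {p q : ℝ} (hω : ‖ω‖ = 1) (hre : 0 ≤ ω.re) (hp : 0 < p) (hq : 0 < q)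
    (h : ω * D = p * (D - 1) ^ 2 - q * (D + 1) ^ 2) :
    0 < (conj ω * (p * (D - 1) ^ 2 + q * (D + 1) ^ 2)).re + (1 + ‖D‖ ^ 2) / 2 := by
  rcases eq_or_ne D 0 with rfl | hD
  · simp; positivity
  · rcases lt_trichotomy p q with hpq | rfl | hpq
    · have := core_bound_of_lt hω hre hp hpq (neg_ne_zero.2 hD) (by linear_combination -h)
      rw [norm_neg] at this
      convert this using 4
      ring
    · exfalso
      have h2 : (ω + 4 * p) * D = 0 := by linear_combination h
      have h3 := (mul_eq_zero.1 h2).resolve_right hD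
      have := congrArg Complex.re h3
      simp at this
      linarith
    · exact core_bound_of_lt hω hre hq hpq hD h

/-- `z` is a nonnegative real number. -/
def IsNonneg (z : ℂ) : Prop := 0 ≤ z.re ∧ z.im = 0

theorem isNonneg_iff {z : ℂ} : IsNonneg z ↔ ∃ r : ℝ, 0 ≤ r ∧ z = r := by
  constructor
  · rintro ⟨h1, h2⟩
    exact ⟨z.re, h1, by apply Complex.ext <;> simp [h2]⟩
  · rintro ⟨r, hr, rfl⟩
    exact ⟨by simpa using hr, by simp⟩

theorem IsNonneg.mul {z w : ℂ} (hz : IsNonneg z) (hw : IsNonneg w) : IsNonneg (z * w) := by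
  rw [isNonneg_iff] at *
  obtain ⟨r, hr, rfl⟩ := hz
  obtain ⟨s, hs, rfl⟩ := hw
  exact ⟨r * s, by positivity, by push_cast; rfl⟩

theorem isNonneg_ofReal {r : ℝ} (hr : 0 ≤ r) : IsNonneg (r : ℂ) := ⟨by simpa using hr, by simp⟩

theorem isNonneg_mul_conj (z : ℂ) : IsNonneg (z * conj z) := by
  rw [Complex.mul_conj]; exact isNonneg_ofReal (Complex.normSq_nonneg z)

/-- Solving the equation `-conj ω E² conj y ∈ ℝ≥0` for `y`. -/
theorem exists_pos_of_isNonneg {ω E y : ℂ} (hω : ‖ω‖ = 1) (hy : y ≠ 0) (hE : E ≠ 0)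
    (h : IsNonneg (-(conj ω * E ^ 2 * conj y))) : ∃ p : ℝ, 0 < p ∧ y = -(p * conj ω * E ^ 2) := by
  obtain ⟨r, hr, hrE⟩ := isNonneg_iff.1 h
  have hωω : ω * conj ω = 1 := by rw [Complex.mul_conj, Complex.normSq_eq_norm_sq, hω]; simp
  have hr0 : r ≠ 0 := by
    rintro rfl
    have : conj y ≠ 0 := by simpa using hy
    simp_all
  refine ⟨Complex.normSq y / r, div_pos (Complex.normSq_pos.2 hy) (by positivity), ?_⟩
  have hr0' : (r : ℂ) ≠ 0 := by exact_mod_cast hr0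
  rw [Complex.ofReal_div, ← Complex.mul_conj]
  field_simp
  linear_combination -hrE

/-- The affine form of `eq_zero_of_splitting`, in the chart `W = 1`. With `D = x - y` the two
conditions give `y = -p conj ω (D - 1)²` and `x = -q conj ω (D + 1)²` with `p, q > 0`, and
`core_bound` contradicts the negativity of the Hermitian form. -/
theorem no_common_point_affine {ω x y : ℂ} (hω : ‖ω‖ = 1) (hre : 0 ≤ ω.re)
    (hneg : ‖x - y‖ ^ 2 + 1 ≤ 2 * (x + y).re)
    (h0 : IsNonneg (-(conj ω * (x - y - 1) ^ 2 * conj y)))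
    (h1 : IsNonneg (-(conj ω * (x - y + 1) ^ 2 * conj x))) : False := by
  have hωω : conj ω * ω = 1 := by
    rw [mul_comm, Complex.mul_conj, Complex.normSq_eq_norm_sq, hω]; simp
  have hxy : 0 < (x + y).re := by nlinarith [sq_nonneg ‖x - y‖]
  -- `-conj ω` is not a nonnegative real, because `Re ω ≥ 0`
  have hneg1 : ∀ r : ℝ, IsNonneg (-(conj ω * r)) → r ≤ 0 := by
    rintro r ⟨h, h'⟩
    simp at h h'
    by_contra! hr
    have h4 : ω.im = 0 := by rcases h' with h' | h' <;> [exact h'; exact absurd h' hr.ne']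
    have h5 : ω.re = 0 := by nlinarith
    have : ω = 0 := Complex.ext h5 h4
    rw [this] at hω; simp at hω
  rcases eq_or_ne x 0 with rfl | hx
  · rcases eq_or_ne y 1 with rfl | hy
    · have := hneg1 4 (by convert h0 using 2; norm_num)
      linarith
    · have : 0 < ‖y - 1‖ ^ 2 := by
        have := norm_pos_iff.2 (sub_ne_zero.2 hy); positivity
      rw [Complex.sq_norm, Complex.normSq_apply] at *
      simp at *
      nlinarith
  rcases eq_or_ne y 0 with rfl | hy
  · rcases eq_or_ne x 1 with rfl | hx1
    · have := hneg1 4 (by convert h1 using 2; norm_num)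
      linarith
    · have : 0 < ‖x - 1‖ ^ 2 := by
        have := norm_pos_iff.2 (sub_ne_zero.2 hx1); positivity
      rw [Complex.sq_norm, Complex.normSq_apply] at *
      simp at *
      nlinarith
  rcases eq_or_ne (x - y - 1) 0 with hD | hD
  · obtain ⟨q, hq, hxq⟩ := exists_pos_of_isNonneg hω hx (by
      intro h; have : (2 : ℂ) = 0 := by linear_combination h - hD
      norm_num at this) h1
    have h2 : x - y + 1 = 2 := by linear_combination hD
    rw [h2] at hxq
    have e1 := congrArg Complex.re hxq
    have e2 := congrArg Complex.re hD
    norm_num at e1 e2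
    simp at hxy
    have : 0 ≤ q * ω.re := by positivity
    linarith
  rcases eq_or_ne (x - y + 1) 0 with hD' | hD'
  · obtain ⟨q, hq, hxq⟩ := exists_pos_of_isNonneg hω hy hD h0
    have h2 : x - y - 1 = -2 := by linear_combination hD'
    rw [h2] at hxq
    have e1 := congrArg Complex.re hxq
    have e2 := congrArg Complex.re hD'
    norm_num at e1 e2
    simp at hxy
    have : 0 ≤ q * ω.re := by positivity
    linarith
  obtain ⟨p, hp, hyp⟩ := exists_pos_of_isNonneg hω hy hD h0
  obtain ⟨q, hq, hxq⟩ := exists_pos_of_isNonneg hω hx hD' h1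
  have hD : ω * (x - y) = p * (x - y - 1) ^ 2 - q * (x - y + 1) ^ 2 := by
    linear_combination ω * hxq - ω * hyp
      + (p * (x - y - 1) ^ 2 - q * (x - y + 1) ^ 2) * hωω
  have := core_bound hω hre hp hq hD
  have e : conj ω * (p * (x - y - 1) ^ 2 + q * (x - y + 1) ^ 2) = -(x + y) := by
    linear_combination hxq + hyp
  rw [e] at this
  simp at this hneg
  linarith

/-- The algebraic heart of the theorem: two consecutive splitting conditions, at a vector on which the
Hermitian form (expressed by the first inequality) is nonpositive, force the last coordinate to
vanish. -/
theorem eq_zero_of_splitting {ω X Y W : ℂ} (hω : ‖ω‖ = 1) (hre : 0 ≤ ω.re)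
    (hneg : ‖X - Y‖ ^ 2 + ‖W‖ ^ 2 ≤ 2 * ((X + Y) * conj W).re)
    (h0 : IsNonneg (-(conj ω * (X - Y - W) ^ 2 * conj (Y * W))))
    (h1 : IsNonneg (-(conj ω * (Y - W - X) ^ 2 * conj (W * X)))) : W = 0 := by
  by_contra hW
  have hW' : conj W ≠ 0 := by simpa using hW
  have hN : 0 < ‖W‖ ^ 2 := by have := norm_pos_iff.2 hW; positivity
  have hNc : ((‖W‖ ^ 2 : ℝ) : ℂ) = W * conj W := by
    rw [Complex.mul_conj, Complex.normSq_eq_norm_sq]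
  have hK : IsNonneg ((W * conj W)⁻¹ ^ 2) := by
    rw [← hNc, ← Complex.ofReal_inv, ← Complex.ofReal_pow]
    exact isNonneg_ofReal (by positivity)
  refine no_common_point_affine (x := X / W) (y := Y / W) hω hre ?_ ?_ ?_
  · have e1 : (X / W - Y / W) = (X - Y) / W := by ring
    have e2 : X / W + Y / W = ((‖W‖ ^ 2)⁻¹ : ℝ) * ((X + Y) * conj W) := by
      rw [Complex.ofReal_inv, hNc]; field_simp
    rw [e1, e2, Complex.re_ofReal_mul, norm_div, div_pow]
    rw [← sub_nonneg] at hneg ⊢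
    have := mul_nonneg (inv_nonneg.2 hN.le) hneg
    refine this.trans_eq ?_
    field_simp
  · convert hK.mul h0 using 1
    simp only [map_div₀, map_mul]
    field_simp
  · convert hK.mul h1 using 1
    simp only [map_div₀, map_mul]
    field_simp
    ring

/-! ### The Hermitian form, lifts and unitary maps -/


theorem herm_add_left (u v w : C3) : herm (u + v) w = herm u w + herm v w := by
  simp [herm]; ring

theorem herm_add_right (u v w : C3) : herm u (v + w) = herm u v + herm u w := by
  simp [herm]; ring

theorem herm_sub_left (u v w : C3) : herm (u - v) w = herm u w - herm v w := by
  simp [herm]; ring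

theorem herm_sub_right (u v w : C3) : herm u (v - w) = herm u v - herm u w := by
  simp [herm]; ring

theorem herm_smul_left (c : ℂ) (v w : C3) : herm (c • v) w = c * herm v w := by
  simp [herm]; ring

theorem herm_smul_right (c : ℂ) (v w : C3) : herm v (c • w) = conj c * herm v w := by
  simp [herm]; ring

theorem herm_zero_left (v : C3) : herm 0 v = 0 := by simp [herm]

theorem conj_herm (v w : C3) : conj (herm v w) = herm w v := by
  simp [herm]; ring

theorem herm_self_im (v : C3) : (herm v v).im = 0 := by
  simp [herm]; ring

theorem herm_self_eq (v : C3) : herm v v = ((herm v v).re : ℂ) :=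
  Complex.ext (by simp) (by simp [herm_self_im])

theorem herm_self_re (v : C3) :
    (herm v v).re = 2 * (v 0 * conj (v 2)).re + ‖v 1‖ ^ 2 := by
  rw [Complex.sq_norm, Complex.normSq_apply]
  simp [herm]; ring

theorem herm_smul_smul_re (c : ℂ) (v : C3) :
    (herm (c • v) (c • v)).re = ‖c‖ ^ 2 * (herm v v).re := by
  rw [herm_smul_left, herm_smul_right, ← mul_assoc, Complex.mul_conj, Complex.re_ofReal_mul,
    Complex.normSq_eq_norm_sq]

/-- The signature of the form: the orthogonal of a negative vector is positive definite. -/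
theorem herm_self_pos_of_orthogonal {n f : C3} (hn : (herm n n).re < 0) (hnf : herm f n = 0)
    (hf : f ≠ 0) : 0 < (herm f f).re := by
  by_contra! hff
  -- diagonalisation of the form
  have hdiag : ∀ v : C3, 2 * (herm v v).re
      = ‖v 0 + v 2‖ ^ 2 + 2 * ‖v 1‖ ^ 2 - ‖v 0 - v 2‖ ^ 2 := by
    intro v
    simp only [Complex.sq_norm, Complex.normSq_apply]
    simp [herm]; ring
  have h1 : (f 0 - f 2) * conj (n 0 - n 2)
      = (f 0 + f 2) * conj (n 0 + n 2) + 2 * (f 1 * conj (n 1)) := by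
    simp [herm] at hnf
    simp only [map_sub, map_add]
    linear_combination -2 * hnf
  have h2 : ‖f 0 - f 2‖ * ‖n 0 - n 2‖
      ≤ ‖f 0 + f 2‖ * ‖n 0 + n 2‖ + 2 * (‖f 1‖ * ‖n 1‖) := by
    have := norm_add_le ((f 0 + f 2) * conj (n 0 + n 2)) (2 * (f 1 * conj (n 1)))
    rw [← h1] at this
    simpa only [norm_mul, Complex.norm_conj, RCLike.norm_conj, Complex.norm_ofNat] using this
  have hn' := hdiag n
  have hf' := hdiag f
  set A := ‖f 0 - f 2‖ with hA
  set B := ‖n 0 - n 2‖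
  set P := ‖f 0 + f 2‖ with hP
  set Q := ‖n 0 + n 2‖
  set R := ‖f 1‖ with hR
  set T := ‖n 1‖
  have hA0 : 0 ≤ A := norm_nonneg _
  have hB0 : 0 ≤ B := norm_nonneg _
  have hP0 : 0 ≤ P := norm_nonneg _
  have hQ0 : 0 ≤ Q := norm_nonneg _
  have hR0 : 0 ≤ R := norm_nonneg _
  have hT0 : 0 ≤ T := norm_nonneg _
  have h3 : (A * B) ^ 2 ≤ (P * Q + 2 * (R * T)) ^ 2 := by gcongr
  have h4 : (P * Q + 2 * (R * T)) ^ 2 ≤ (P ^ 2 + 2 * R ^ 2) * (Q ^ 2 + 2 * T ^ 2) := by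
    nlinarith [sq_nonneg (P * T - Q * R)]
  have h5 : (P ^ 2 + 2 * R ^ 2) * (Q ^ 2 + 2 * T ^ 2) ≤ A ^ 2 * (Q ^ 2 + 2 * T ^ 2) := by
    gcongr; linarith
  have h6 : A ^ 2 * (B ^ 2 - (Q ^ 2 + 2 * T ^ 2)) ≤ 0 := by nlinarith
  have h7 : A ^ 2 ≤ 0 := by
    by_contra! h
    have : 0 < B ^ 2 - (Q ^ 2 + 2 * T ^ 2) := by linarith
    have := mul_pos h this
    linarith
  have hA' : A = 0 := by nlinarith
  have hR' : R = 0 := by nlinarith [sq_nonneg P]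
  have hP' : P = 0 := by nlinarith
  rw [hA, norm_eq_zero] at hA'
  rw [hP, norm_eq_zero] at hP'
  rw [hR, norm_eq_zero] at hR'
  apply hf
  ext i
  fin_cases i
  · simpa using (by linear_combination (hA' + hP') / 2 : f 0 = 0)
  · simpa using hR'
  · simpa using (by linear_combination (hP' - hA') / 2 : f 2 = 0)

/-- A nonzero vector that is null or negative is never orthogonal to a negative vector. -/
theorem herm_ne_zero_of_neg {v n : C3} (hn : (herm n n).re < 0) (hv : v ≠ 0)
    (hvv : (herm v v).re ≤ 0) : herm v n ≠ 0 := fun h =>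
  absurd (herm_self_pos_of_orthogonal hn h hv) (not_lt.2 hvv)

/-- Two orthogonal null vectors are proportional. -/
theorem exists_smul_eq_of_null {a c : C3} (ha : a ≠ 0) (hc : c ≠ 0) (haa : herm a a = 0)
    (hcc : herm c c = 0) (hac : herm a c = 0) : ∃ k : ℂ, k ≠ 0 ∧ c = k • a := by
  have hn : (herm ![-1, 0, 1] ![-1, 0, 1]).re < 0 := by simp [herm]
  set n : C3 := ![-1, 0, 1]
  have h1 := herm_ne_zero_of_neg hn ha (by simp [haa])
  have h2 := herm_ne_zero_of_neg hn hc (by simp [hcc])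
  have hca : herm c a = 0 := by rw [← conj_herm, hac, map_zero]
  refine ⟨herm c n / herm a n, div_ne_zero h2 h1, ?_⟩
  by_contra h
  have h3 := herm_self_pos_of_orthogonal (f := c - (herm c n / herm a n) • a) hn
    (by rw [herm_sub_left, herm_smul_left]; field_simp; ring) (sub_ne_zero.2 h)
  simp [herm_sub_left, herm_sub_right, herm_smul_left, herm_smul_right, haa, hcc, hac, hca] at h3

theorem isLift_rep (m : CP2) : IsLift m.rep m := ⟨m.rep_nonzero, m.mk_rep⟩

theorem isLift_mk {v : C3} (hv : v ≠ 0) : IsLift v (Projectivization.mk ℂ v hv) := ⟨hv, rfl⟩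

theorem IsLift.ne_zero {v : C3} {m : CP2} (h : IsLift v m) : v ≠ 0 := h.1

theorem IsLift.smul {v : C3} {m : CP2} (h : IsLift v m) {c : ℂ} (hc : c ≠ 0) :
    IsLift (c • v) m := by
  obtain ⟨hv, rfl⟩ := h
  refine ⟨smul_ne_zero hc hv, ?_⟩
  rw [Projectivization.mk_eq_mk_iff']
  exact ⟨c, rfl⟩

theorem IsLift.exists_smul {v w : C3} {m : CP2} (hv : IsLift v m) (hw : IsLift w m) :
    ∃ c : ℂ, c ≠ 0 ∧ w = c • v := by
  obtain ⟨hv0, rfl⟩ := hv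
  obtain ⟨hw0, h⟩ := hw
  rw [Projectivization.mk_eq_mk_iff'] at h
  obtain ⟨c, rfl⟩ := h
  exact ⟨c, by rintro rfl; simp at hw0, rfl⟩

theorem IsLift.unique {v : C3} {m n : CP2} (hm : IsLift v m) (hn : IsLift v n) : m = n := by
  obtain ⟨_, rfl⟩ := hm
  obtain ⟨_, rfl⟩ := hn
  rfl

theorem IsLift.mem_H2C_iff {v : C3} {m : CP2} (h : IsLift v m) :
    m ∈ H2C ↔ (herm v v).re < 0 := by
  obtain ⟨c, hc, hr⟩ := (isLift_rep m).exists_smul h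
  rw [hr, herm_smul_smul_re]
  have : 0 < ‖c‖ ^ 2 := by have := norm_pos_iff.2 hc; positivity
  change (herm m.rep m.rep).re < 0 ↔ _
  exact (mul_neg_iff.trans ⟨fun h => (h.resolve_right fun h' => absurd this h'.1.not_gt).2,
    fun h => Or.inl ⟨this, h⟩⟩).symm

theorem IsLift.mem_boundary_iff {v : C3} {m : CP2} (h : IsLift v m) :
    m ∈ boundary ↔ herm v v = 0 := by
  obtain ⟨c, hc, hr⟩ := (isLift_rep m).exists_smul h
  rw [hr, herm_smul_left, herm_smul_right]
  simp [boundary, hc]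

theorem isLift_act {v : C3} {m : CP2} (h : IsLift v m) (A : C3 ≃ₗ[ℂ] C3) :
    IsLift (A v) (act A m) := by
  obtain ⟨hv, rfl⟩ := h
  exact ⟨by simpa using hv, rfl⟩

theorem act_symm_act (A : C3 ≃ₗ[ℂ] C3) (m : CP2) : act A.symm (act A m) = m := by
  have h := isLift_act (isLift_act (isLift_rep m) A) A.symm
  rw [LinearEquiv.symm_apply_apply] at h
  exact h.unique (isLift_rep m)

theorem act_act_symm (A : C3 ≃ₗ[ℂ] C3) (m : CP2) : act A (act A.symm m) = m :=
  act_symm_act A.symm m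

theorem isLift_act_iff {v : C3} {m : CP2} (A : C3 ≃ₗ[ℂ] C3) :
    IsLift (A v) (act A m) ↔ IsLift v m := by
  refine ⟨fun h => ?_, fun h => isLift_act h A⟩
  have := isLift_act h A.symm
  rwa [LinearEquiv.symm_apply_apply, act_symm_act] at this

theorem IsUnitary.symm {A : C3 ≃ₗ[ℂ] C3} (hA : IsUnitary A) : IsUnitary A.symm := fun v w => by
  have := hA (A.symm v) (A.symm w)
  simpa using this.symm

theorem IsUnitary.act_mem_H2C_iff {A : C3 ≃ₗ[ℂ] C3} (hA : IsUnitary A) {m : CP2} :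
    act A m ∈ H2C ↔ m ∈ H2C := by
  rw [(isLift_act (isLift_rep m) A).mem_H2C_iff, (isLift_rep m).mem_H2C_iff, hA]

/-- Distances to a fixed point are compared through the Hermitian form of lifts. The quotients below
are positive on `H2C`, where `arcosh ∘ sqrt` is strictly increasing. -/
theorem hdist_le_hdist_iff {m x y : CP2} {v u w : C3} (hv : IsLift v m) (hu : IsLift u x)
    (hw : IsLift w y) (hm : m ∈ H2C) (hx : x ∈ H2C) (hy : y ∈ H2C) :
    hdist m x ≤ hdist m y ↔
      ‖herm v u‖ ^ 2 * -(herm w w).re ≤ ‖herm v w‖ ^ 2 * -(herm u u).re := by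
  have key : ∀ (n : CP2) (z : C3), IsLift z n → n ∈ H2C →
      ∃ r : ℝ, 0 < r ∧ r = ‖herm v z‖ ^ 2 / ((herm v v).re * (herm z z).re) ∧
        hdist m n = 2 * Real.arcosh (Real.sqrt r) := by
    intro n z hz hn
    obtain ⟨c, hc, rfl⟩ := (isLift_rep m).exists_smul hv
    obtain ⟨d, hd, rfl⟩ := (isLift_rep n).exists_smul hz
    have h1 := (isLift_rep m).mem_H2C_iff.1 hm
    have h2 := (isLift_rep n).mem_H2C_iff.1 hn
    have h3 := herm_ne_zero_of_neg h2 m.rep_nonzero h1.le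
    refine ⟨_, ?_, rfl, ?_⟩
    · have : 0 < (herm (c • m.rep) (c • m.rep)).re * (herm (d • n.rep) (d • n.rep)).re :=
        mul_pos_of_neg_of_neg (hv.mem_H2C_iff.1 hm) (hz.mem_H2C_iff.1 hn)
      have h4 : 0 < ‖herm (c • m.rep) (d • n.rep)‖ := by
        rw [norm_pos_iff, herm_smul_left, herm_smul_right]
        simp [hc, hd, h3]
      positivity
    · rw [hdist, herm_smul_smul_re, herm_smul_smul_re, herm_smul_left, herm_smul_right]
      congr 3
      rw [← conj_herm m.rep n.rep, Complex.mul_conj, herm_self_eq m.rep, herm_self_eq n.rep,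
        Complex.normSq_eq_norm_sq]
      norm_cast
      simp only [norm_mul, RCLike.norm_conj]
      have : ‖c‖ ≠ 0 := norm_ne_zero_iff.2 hc
      have : ‖d‖ ≠ 0 := norm_ne_zero_iff.2 hd
      have := h1.ne
      have := h2.ne
      field_simp
  obtain ⟨r, hr, hr', hrd⟩ := key x u hu hx
  obtain ⟨s, hs, hs', hsd⟩ := key y w hw hy
  rw [hrd, hsd, mul_le_mul_iff_right₀ two_pos,
    Real.arcosh_le_arcosh (Real.sqrt_pos.2 hr) (Real.sqrt_pos.2 hs), Real.sqrt_le_sqrt_iff hs.le,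
    hr', hs']
  have h1 := hv.mem_H2C_iff.1 hm
  have h2 := hu.mem_H2C_iff.1 hx
  have h3 := hw.mem_H2C_iff.1 hy
  rw [div_le_div_iff₀ (mul_pos_of_neg_of_neg h1 h2) (mul_pos_of_neg_of_neg h1 h3)]
  have e1 : ‖herm v u‖ ^ 2 * ((herm v v).re * (herm w w).re)
      = -(herm v v).re * (‖herm v u‖ ^ 2 * -(herm w w).re) := by ring
  have e2 : ‖herm v w‖ ^ 2 * ((herm v v).re * (herm u u).re)
      = -(herm v v).re * (‖herm v w‖ ^ 2 * -(herm u u).re) := by ring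
  rw [e1, e2, mul_le_mul_iff_right₀ (neg_pos.2 h1)]

theorem isLift_infty : IsLift ![1, 0, 0] infty := ⟨inftyLift_ne_zero, rfl⟩

theorem isLift_heis (z : ℂ) (t : ℝ) : IsLift (heisLift z t) (heis z t) := ⟨heisLift_ne_zero z t, rfl⟩

theorem isLift_heis_zero : IsLift ![0, 0, 1] (heis 0 0) := by
  have := isLift_heis 0 0
  simpa [heisLift] using this

/-- A basis with the same Gram matrix as the standard one is sent to it by a unitary map. The vectors
need not be assumed independent: preserving a nondegenerate form makes the map injective. -/
theorem exists_unitary {f₀ f₁ f₂ : C3} (h00 : herm f₀ f₀ = 0) (h01 : herm f₀ f₁ = 0)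
    (h02 : herm f₀ f₂ = 1) (h11 : herm f₁ f₁ = 1) (h12 : herm f₁ f₂ = 0) (h22 : herm f₂ f₂ = 0) :
    ∃ A : C3 ≃ₗ[ℂ] C3, IsUnitary A ∧
      ∀ x y z : ℂ, A (x • f₀ + y • f₁ + z • f₂) = ![x, y, z] := by
  have h10 : herm f₁ f₀ = 0 := by rw [← conj_herm, h01, map_zero]
  have h20 : herm f₂ f₀ = 1 := by rw [← conj_herm, h02, map_one]
  have h21 : herm f₂ f₁ = 0 := by rw [← conj_herm, h12, map_zero]
  let B : C3 →ₗ[ℂ] C3 :=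
    { toFun := fun v => v 0 • f₀ + v 1 • f₁ + v 2 • f₂
      map_add' := fun v w => by simp only [Pi.add_apply, add_smul]; abel
      map_smul' := fun c v => by
        simp only [Pi.smul_apply, smul_eq_mul, mul_smul, smul_add, RingHom.id_apply] }
  have hB : ∀ v w, herm (B v) (B w) = herm v w := by
    intro v w
    change herm (v 0 • f₀ + v 1 • f₁ + v 2 • f₂) (w 0 • f₀ + w 1 • f₁ + w 2 • f₂) = _
    simp only [herm_add_left, herm_add_right, herm_smul_left, herm_smul_right, h00, h01, h02, h10,
      h11, h12, h20, h21, h22]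
    simp [herm]
    ring
  have hinj : Function.Injective B := by
    rw [injective_iff_map_eq_zero]
    intro v hv
    have h : ∀ w, herm v w = 0 := fun w => by rw [← hB, hv, herm_zero_left]
    ext i
    fin_cases i
    · simpa [herm] using h ![0, 0, 1]
    · simpa [herm] using h ![0, 1, 0]
    · simpa [herm] using h ![1, 0, 0]
  let e := LinearEquiv.ofInjectiveEndo B hinj
  have he : ∀ v, e v = B v := fun v => by simp [e]
  refine ⟨e.symm, ?_, ?_⟩
  · exact IsUnitary.symm fun v w => by rw [he, he, hB]
  · intro x y z
    rw [LinearEquiv.symm_apply_eq, he]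
    simp [B]

/-! ### Normal forms of pairs of real ideal triangles -/


theorem IsLift.eq_of_smul {v w : C3} {m n : CP2} (hv : IsLift v m) (hw : IsLift w n) {c : ℂ}
    (h : w = c • v) : m = n := by
  have hc : c ≠ 0 := by rintro rfl; exact hw.ne_zero (by simpa using h)
  exact (hv.smul hc).unique (h ▸ hw)

theorem herm_ne_zero_of_ne {v w : C3} {m n : CP2} (hv : IsLift v m) (hw : IsLift w n)
    (hm : m ∈ boundary) (hn : n ∈ boundary) (hmn : m ≠ n) : herm v w ≠ 0 := by
  intro h
  obtain ⟨k, -, hk⟩ := exists_smul_eq_of_null hv.ne_zero hw.ne_zero (hv.mem_boundary_iff.1 hm)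
    (hw.mem_boundary_iff.1 hn) h
  exact hmn (hv.eq_of_smul hw hk)

/-- `PU(2,1)` acts transitively on real ideal triangles. Lifts `x`, `y`, `w` in a common Lagrangian have
real products; the component of `y` orthogonal to `x` and `w` is positive and gives the middle
vector of the new basis, and the sign of its norm makes the required rescaling possible. -/
theorem exists_unitary_of_triangle {a b c : CP2} (h : IsRealIdealTriangle a b c) :
    ∃ A : C3 ≃ₗ[ℂ] C3, IsUnitary A ∧ act A a = infty ∧ act A b = heis (-1) 0 ∧
      act A c = heis 0 0 := by
  obtain ⟨hab, hbc, hac, P, ⟨ha, x, hxP, hx⟩, ⟨hb, y, hyP, hy⟩, ⟨hc, w, hwP, hw⟩⟩ := h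
  have hxx := hx.mem_boundary_iff.1 ha
  have hyy := hy.mem_boundary_iff.1 hb
  have hww := hw.mem_boundary_iff.1 hc
  have hreal : ∀ v ∈ P.lag, ∀ w ∈ P.lag, ∃ r : ℝ, herm v w = r := fun v hv w hw =>
    ⟨(herm v w).re, Complex.ext (by simp) (by simp [P.im_herm v hv w hw])⟩
  obtain ⟨g, hg⟩ := hreal x hxP w hwP
  obtain ⟨α, hα⟩ := hreal y hyP w hwP
  obtain ⟨β, hβ⟩ := hreal y hyP x hxP
  have hwx : herm w x = g := by rw [← conj_herm, hg, Complex.conj_ofReal]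
  have hwy : herm w y = α := by rw [← conj_herm, hα, Complex.conj_ofReal]
  have hxy : herm x y = β := by rw [← conj_herm, hβ, Complex.conj_ofReal]
  have hg0 : (g : ℂ) ≠ 0 := hg ▸ herm_ne_zero_of_ne hx hw ha hc hac
  have hg0' : g ≠ 0 := by exact_mod_cast hg0
  have hα0 : (α : ℂ) ≠ 0 := hα ▸ herm_ne_zero_of_ne hy hw hb hc hbc
  have hβ0 : (β : ℂ) ≠ 0 := hβ ▸ herm_ne_zero_of_ne hy hx hb ha hab.symm
  have hα0' : α ≠ 0 := by exact_mod_cast hα0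
  have hβ0' : β ≠ 0 := by exact_mod_cast hβ0
  -- `f` is the component of `y` orthogonal to `x` and `w`
  set f : C3 := y - (α / g : ℂ) • x - (β / g : ℂ) • w with hf
  have hfx : herm f x = 0 := by
    simp only [hf, herm_sub_left, herm_smul_left, hxx, hβ, hwx]; field_simp; ring
  have hfw : herm f w = 0 := by
    simp only [hf, herm_sub_left, herm_smul_left, hww, hα, hg]; field_simp; ring
  have hff : herm f f = -2 * α * β / g := by
    have : herm f f = herm f y := by
      have : herm f f = herm f (y - (α / g : ℂ) • x - (β / g : ℂ) • w) := rfl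
      rw [this, herm_sub_right, herm_sub_right, herm_smul_right, herm_smul_right, hfx, hfw]
      ring
    rw [this]
    simp only [hf, herm_sub_left, herm_smul_left, hyy, hxy, hwy]
    field_simp; ring
  have hf0 : f ≠ 0 := by
    intro h
    rw [h, herm_zero_left] at hff
    field_simp at hff
    simp [hα0', hβ0'] at hff
  have hn : (herm ((g : ℂ) • x - w) ((g : ℂ) • x - w)).re < 0 := by
    simp only [herm_sub_left, herm_sub_right, herm_smul_left, herm_smul_right, hxx, hww, hg, hwx]
    simp
    nlinarith [mul_self_pos.2 hg0']
  have hpos := herm_self_pos_of_orthogonal hn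
    (by rw [herm_sub_right, herm_smul_right, hfx, hfw]; ring) hf0
  rw [hff] at hpos
  have hpos' : 0 < -2 * α * β / g := by exact_mod_cast hpos
  -- rescaling by `k` puts `y` in the position of `[-1, 0]`
  obtain ⟨k, hk, hkk⟩ : ∃ k : ℝ, 0 < k ∧ k ^ 2 = -α / (β * g) := by
    have : 0 < -α / (β * g) := by
      have : -α / (β * g) = (-2 * α * β / g) * (1 / (2 * β ^ 2)) := by field_simp
      rw [this]; positivity
    exact ⟨Real.sqrt (-α / (β * g)), Real.sqrt_pos.2 this, Real.sq_sqrt this.le⟩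
  have hk0 : (k : ℂ) ≠ 0 := by exact_mod_cast hk.ne'
  have hkk' : (k : ℂ) ^ 2 * (β * g) = -α := by
    have : k ^ 2 * (β * g) = -α := by rw [hkk]; field_simp
    exact_mod_cast this
  have hs0 : ((Real.sqrt 2 : ℝ) : ℂ) ≠ 0 := by
    exact_mod_cast (Real.sqrt_pos.2 two_pos).ne'
  have hs2 : ((Real.sqrt 2 : ℝ) : ℂ) ^ 2 = 2 := by
    exact_mod_cast Real.sq_sqrt zero_le_two
  set s : ℝ := Real.sqrt 2
  obtain ⟨A, hA, hAf⟩ := exists_unitary (f₀ := (k : ℂ) • x)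
      (f₁ := (-1 / (s * β * k) : ℂ) • f) (f₂ := (1 / (k * g) : ℂ) • w)
    (by simp only [herm_smul_left, herm_smul_right, hxx]; ring)
    (by simp only [herm_smul_left, herm_smul_right, ← conj_herm f x, hfx, map_zero]; ring)
    (by
      simp only [herm_smul_left, herm_smul_right, hg, map_div₀, map_mul, map_one,
        Complex.conj_ofReal]
      field_simp)
    (by
      simp only [herm_smul_left, herm_smul_right, hff, map_div₀, map_mul, map_neg, map_one,
        Complex.conj_ofReal]
      field_simp
      rw [hs2]
      linear_combination (-2 : ℂ) * hkk')
    (by simp [herm_smul_left, herm_smul_right, hfw])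
    (by simp [herm_smul_left, herm_smul_right, hww])
  have hA0 : A ((k : ℂ) • x) = ![1, 0, 0] := by simpa using hAf 1 0 0
  have hA2 : A ((1 / (k * g) : ℂ) • w) = ![0, 0, 1] := by simpa using hAf 0 0 1
  have hAy : A ((1 / (β * k) : ℂ) • y) = heisLift (-1) 0 := by
    have h1 := hAf (-1) (-s) 1
    have h2 : (1 / (β * k) : ℂ) • y = (-1 : ℂ) • (k : ℂ) • x
        + (-s : ℂ) • (-1 / (s * β * k) : ℂ) • f + (1 : ℂ) • (1 / (k * g) : ℂ) • w := by
      ext i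
      simp only [hf, Pi.add_apply, Pi.sub_apply, Pi.smul_apply, smul_eq_mul]
      field_simp
      linear_combination x i * hkk'
    rw [h2, h1]
    simp [heisLift, s]
  refine ⟨A, hA, ?_, ?_, ?_⟩
  · exact (isLift_act (hx.smul hk0) A).unique (hA0 ▸ isLift_infty)
  · exact (isLift_act (hy.smul (by simp [hβ0', hk.ne'])) A).unique (hAy ▸ isLift_heis _ _)
  · exact (isLift_act (hw.smul (by simp [hg0', hk.ne'])) A).unique (hA2 ▸ isLift_heis_zero)

/-- The triple product of lifts of the vertices of a real ideal triangle is real, for arbitrary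
lifts. -/
theorem IsRealIdealTriangle.herm_prod_im {a b c : CP2} (h : IsRealIdealTriangle a b c)
    {x y w : C3} (hx : IsLift x a) (hy : IsLift y b) (hw : IsLift w c) :
    (herm x y * herm y w * herm w x).im = 0 := by
  obtain ⟨-, -, -, P, ⟨-, x', hxP, hx'⟩, ⟨-, y', hyP, hy'⟩, ⟨-, w', hwP, hw'⟩⟩ := h
  obtain ⟨r, -, rfl⟩ := hx'.exists_smul hx
  obtain ⟨s, -, rfl⟩ := hy'.exists_smul hy
  obtain ⟨t, -, rfl⟩ := hw'.exists_smul hw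
  have hreal : ∀ v ∈ P.lag, ∀ w ∈ P.lag, herm v w = ((herm v w).re : ℝ) := fun v hv w hw =>
    Complex.ext (by simp) (by simp [P.im_herm v hv w hw])
  have : herm (r • x') (s • y') * herm (s • y') (t • w') * herm (t • w') (r • x')
      = (r * conj r) * (s * conj s) * (t * conj t) * (herm x' y' * herm y' w' * herm w' x') := by
    simp only [herm_smul_left, herm_smul_right]; ring
  rw [this, hreal x' hxP y' hyP, hreal y' hyP w' hwP, hreal w' hwP x' hxP, Complex.mul_conj,
    Complex.mul_conj, Complex.mul_conj]
  norm_cast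

/-- A pair of adjacent real ideal triangles has an invariant, so that `Z` is not a junk value. -/
theorem exists_hasInvariant {a b c d : CP2} (h : IsRealIdealTriangle a b c)
    (h' : IsRealIdealTriangle a c d) : ∃ z, HasInvariant a b c d z := by
  obtain ⟨A, hA, ha, hb, hc⟩ := exists_unitary_of_triangle h
  obtain ⟨hac, hcd, had, P, hPa, hPc, hPd⟩ := id h'
  have hx : IsLift (A.symm ![1, 0, 0]) a := by
    rw [← isLift_act_iff A, ha, A.apply_symm_apply]; exact isLift_infty
  have hy : IsLift (A.symm ![0, 0, 1]) c := by
    rw [← isLift_act_iff A, hc, A.apply_symm_apply]; exact isLift_heis_zero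
  have hv := isLift_rep d
  have hne := herm_ne_zero_of_ne hv hx hPd.1 hPa.1 had.symm
  have him := h'.herm_prod_im hx hy hv
  have hnull := hv.mem_boundary_iff.1 hPd.1
  have hAv := isLift_act hv A
  rw [← hA] at hne hnull
  simp only [← hA _ (A.symm _), ← hA (A.symm _), A.apply_symm_apply] at him hne
  set v := A d.rep
  have hv2 : v 2 ≠ 0 := by simpa [herm] using hne
  have him' : (conj (v 0) * v 2).im = 0 := by simpa [herm] using him
  have hnull' : 2 * (v 0 * conj (v 2)).re + ‖v 1‖ ^ 2 = 0 := by
    rw [← herm_self_re, hnull, Complex.zero_re]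
  have hN : ((‖v 2‖ ^ 2 : ℝ) : ℂ) = v 2 * conj (v 2) := by
    rw [Complex.mul_conj, Complex.normSq_eq_norm_sq]
  have hs0 : ((Real.sqrt 2 : ℝ) : ℂ) ≠ 0 := by
    exact_mod_cast (Real.sqrt_pos.2 two_pos).ne'
  refine ⟨v 1 / v 2 / (Real.sqrt 2 : ℝ), A, hA, ha, hb, hc, ?_⟩
  refine (hAv.smul (inv_ne_zero hv2)).unique ?_
  convert isLift_heis _ _ using 1
  ext i
  fin_cases i
  · have h0 : v 0 * conj (v 2) = ((-‖v 1‖ ^ 2 / 2 : ℝ) : ℂ) := by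
      apply Complex.ext
      · rw [Complex.ofReal_re]; linarith
      · rw [Complex.ofReal_im]
        simp only [Complex.mul_im, Complex.conj_re, Complex.conj_im] at him' ⊢
        linarith
    have h1 : (v 2)⁻¹ * v 0 = v 0 * conj (v 2) / ((‖v 2‖ ^ 2 : ℝ) : ℂ) := by
      have : conj (v 2) ≠ 0 := by simpa using hv2
      rw [hN]; field_simp
    simp only [heisLift, norm_div, div_pow, Complex.norm_real, Real.norm_eq_abs, sq_abs]
    rw [Real.sq_sqrt zero_le_two]
    simp only [Fin.zero_eta, Pi.smul_apply, smul_eq_mul, h1, h0]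
    simp
    field_simp
  · simp [heisLift]
    field_simp
  · simp [heisLift, hv2]

/-! ### Real planes in standard position -/


/-- The real plane spanned by the image of an injective real linear map `ℝ³ → ℂ³`. -/
noncomputable def RealPlane.ofMap (T : (Fin 3 → ℝ) →ₗ[ℝ] C3) (hT : Function.Injective T)
    (him : ∀ s t, (herm (T s) (T t)).im = 0) (hneg : ∃ t, (herm (T t) (T t)).re < 0) :
    RealPlane where
  lag := LinearMap.range T
  finrank_lag := by rw [LinearMap.finrank_range_of_inj hT]; simp
  im_herm := by rintro _ ⟨s, rfl⟩ _ ⟨t, rfl⟩; exact him s t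
  exists_neg := by obtain ⟨t, ht⟩ := hneg; exact ⟨T t, ⟨t, rfl⟩, ht⟩

/-- The parametrisation of the Lagrangian spanned over `ℝ` by `e₀`, `u e₁`, `e₂`. -/
noncomputable def planeMap (u : ℂ) : (Fin 3 → ℝ) →ₗ[ℝ] C3 where
  toFun t := ![t 0, t 1 * u, t 2]
  map_add' s t := by
    ext i; fin_cases i <;> simp [add_mul]
  map_smul' c t := by
    ext i; fin_cases i <;> simp [mul_assoc]

/-- The real plane with Lagrangian spanned over `ℝ` by `e₀`, `u e₁`, `e₂`. -/
noncomputable def stdPlane (u : ℂ) (hu : ‖u‖ = 1) : RealPlane :=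
  RealPlane.ofMap (planeMap u)
    (by
      have hu0 : u ≠ 0 := by rintro rfl; simp at hu
      rw [injective_iff_map_eq_zero]
      intro t ht
      have h0 := congrFun ht 0
      have h1 := congrFun ht 1
      have h2 := congrFun ht 2
      simp [planeMap, hu0] at h0 h1 h2
      ext i; fin_cases i <;> simpa)
    (by
      intro s t
      simp [herm, planeMap]
      ring)
    ⟨![-1, 0, 1], by simp [herm, planeMap]⟩

/-- The parametrisation of the Lagrangian of all `(w, s u, conj w / ρ)` with `w` complex, `s` real. -/
noncomputable def mirrorMap (u : ℂ) (ρ : ℝ) : (Fin 3 → ℝ) →ₗ[ℝ] C3 where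
  toFun t := ![t 0 + t 1 * Complex.I, t 2 * u, (t 0 - t 1 * Complex.I) / ρ]
  map_add' s t := by
    ext i; fin_cases i <;> simp <;> ring
  map_smul' c t := by
    ext i; fin_cases i <;> simp <;> ring

/-- The real plane whose Lagrangian consists of all `(w, s u, conj w / ρ)` with `w` complex,
`s` real. It is orthogonal to `stdPlane u` at the point `[(-ρ, 0, 1)]`. -/
noncomputable def stdMirror (u : ℂ) (hu : ‖u‖ = 1) (ρ : ℝ) (hρ : 0 < ρ) : RealPlane :=
  RealPlane.ofMap (mirrorMap u ρ)
    (by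
      have hu0 : u ≠ 0 := by rintro rfl; simp at hu
      rw [injective_iff_map_eq_zero]
      intro t ht
      have h0 := congrArg Complex.re (congrFun ht 0)
      have h1 := congrArg Complex.im (congrFun ht 0)
      have h2 := congrFun ht 1
      simp [mirrorMap, hu0] at h0 h1 h2
      ext i; fin_cases i <;> simpa)
    (by
      intro s t
      simp [herm, mirrorMap, Complex.div_re, Complex.div_im]
      ring)
    ⟨![0, 1, 0], by
      simp [herm, mirrorMap, Complex.div_re, Complex.div_im]
      field_simp
      norm_num⟩

theorem mem_stdPlane_points {u : ℂ} {hu : ‖u‖ = 1} {m : CP2} : m ∈ (stdPlane u hu).points ↔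
    m ∈ H2C ∧ ∃ t₀ t₁ t₂ : ℝ, IsLift ![(t₀ : ℂ), t₁ * u, t₂] m := by
  refine and_congr_right fun _ => ⟨?_, ?_⟩
  · rintro ⟨_, ⟨t, rfl⟩, h⟩
    exact ⟨t 0, t 1, t 2, h⟩
  · rintro ⟨t₀, t₁, t₂, h⟩
    exact ⟨_, ⟨![t₀, t₁, t₂], rfl⟩, h⟩

theorem mirrorMap_apply (u : ℂ) (ρ : ℝ) (w : ℂ) (s : ℝ) :
    mirrorMap u ρ ![w.re, w.im, s] = ![w, s * u, conj w / ρ] := by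
  ext i
  fin_cases i
  · simp [mirrorMap, Complex.re_add_im]
  · simp [mirrorMap]
  · have : (w.re : ℂ) - w.im * Complex.I = conj w := by
      apply Complex.ext <;> simp
    simp [mirrorMap, this]

theorem mem_stdMirror_points {u : ℂ} {hu : ‖u‖ = 1} {ρ : ℝ} {hρ : 0 < ρ} {m : CP2} :
    m ∈ (stdMirror u hu ρ hρ).points ↔
      m ∈ H2C ∧ ∃ (w : ℂ) (s : ℝ), IsLift ![w, s * u, conj w / ρ] m := by
  refine and_congr_right fun _ => ⟨?_, ?_⟩
  · rintro ⟨_, ⟨t, rfl⟩, h⟩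
    refine ⟨t 0 + t 1 * Complex.I, t 2, ?_⟩
    rw [← mirrorMap_apply]
    convert h
    ext i; fin_cases i <;> simp
  · rintro ⟨w, s, h⟩
    exact ⟨_, ⟨![w.re, w.im, s], mirrorMap_apply u ρ w s⟩, h⟩

theorem stdMirror_symmMaps_infty {u : ℂ} {hu : ‖u‖ = 1} {ρ : ℝ} {hρ : 0 < ρ} :
    (stdMirror u hu ρ hρ).SymmMaps infty (heis 0 0) := by
  have hρ0 : (ρ : ℂ) ≠ 0 := by exact_mod_cast hρ.ne'
  refine ⟨_, ⟨![(1 : ℂ).re, (1 : ℂ).im, (0 : ℝ)], mirrorMap_apply u ρ 1 0⟩, _,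
    ⟨![(-Complex.I : ℂ).re, (-Complex.I : ℂ).im, (0 : ℝ)], mirrorMap_apply u ρ (-Complex.I) 0⟩,
    ?_, ?_⟩
  · convert isLift_infty.smul (two_ne_zero (α := ℂ)) using 1
    ext i; fin_cases i
    · simp; norm_num
    · simp
    · simp; field_simp; simp
  · convert isLift_heis_zero.smul (c := (2 / ρ : ℂ)) (by simp [hρ.ne']) using 1
    ext i; fin_cases i
    · simp
    · simp
    · simp; field_simp; simp; norm_num

/-- The symmetry about `stdMirror u ρ` is `(v₀, v₁, v₂) ↦ (ρ conj v₂, u² conj v₁, conj v₀ / ρ)`, which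
maps the lift of `[-1, 0]` to a multiple of that of `[u² ρ, 0]`. -/
theorem stdMirror_symmMaps_heis {u z : ℂ} {hu : ‖u‖ = 1} {ρ : ℝ} {hρ : 0 < ρ}
    (hz : u ^ 2 * ρ = z) : (stdMirror u hu ρ hρ).SymmMaps (heis (-1) 0) (heis z 0) := by
  have hρ0 : (ρ : ℂ) ≠ 0 := by exact_mod_cast hρ.ne'
  have hzn : ‖z‖ = ρ := by rw [← hz]; simp [hu, abs_of_pos hρ]
  have huu : u * conj u = 1 := by rw [Complex.mul_conj, Complex.normSq_eq_norm_sq, hu]; simp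
  have hur : (conj u + u) = ((2 * u.re : ℝ) : ℂ) := by
    rw [add_comm, Complex.add_conj]
  have hui : (conj u - u) = ((-2 * u.im : ℝ) : ℂ) * Complex.I := by
    rw [← neg_sub, Complex.sub_conj]; push_cast; ring
  set s : ℝ := Real.sqrt 2
  -- with `σ` the symmetry, the two points have lifts `x ± i y`, `x = (b + σ b) / 2`,
  -- `y = (b - σ b) / (2 i)`
  refine ⟨_, ⟨![((-1 + ρ : ℝ) / 2 : ℂ).re, ((-1 + ρ : ℝ) / 2 : ℂ).im, -s * u.re],
      mirrorMap_apply u ρ ((-1 + ρ : ℝ) / 2) (-s * u.re)⟩, _,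
    ⟨![(((1 + ρ : ℝ) / 2 : ℂ) * Complex.I).re, (((1 + ρ : ℝ) / 2 : ℂ) * Complex.I).im, s * u.im],
      mirrorMap_apply u ρ (((1 + ρ : ℝ) / 2 : ℂ) * Complex.I) (s * u.im)⟩, ?_, ?_⟩
  · convert isLift_heis (-1) 0 using 1
    ext i; fin_cases i
    · simp [heisLift]; linear_combination ((1 + ρ) / 2 : ℂ) * Complex.I_mul_I
    · simp [heisLift]
      push_cast at hur hui
      linear_combination -(s : ℂ) * huu + (s * u / 2 : ℂ) * hur + (s * u / 2 : ℂ) * hui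
    · simp [heisLift]; field_simp
      simp only [map_ofNat]
      ring_nf
      simp only [Complex.I_sq]
      ring
  · convert (isLift_heis z 0).smul (c := (-1 / ρ : ℂ)) (by simp [hρ.ne']) using 1
    ext i; fin_cases i
    · simp [heisLift, hzn]; field_simp; simp; ring
    · simp [heisLift]
      push_cast at hur hui
      rw [← hz]
      field_simp
      linear_combination (-(s * u) : ℂ) * Complex.re_add_im u
    · simp [heisLift]; field_simp
      simp only [map_ofNat]
      ring_nf
      simp only [Complex.I_sq]
      ring

/-! ### Fibres of the orthogonal projection -/


/-- The points of `P` are those having a lift in the real span of `e₀`, `u e₁`, `e₂`. -/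
def IsStdPlane (P : RealPlane) (u : ℂ) : Prop :=
  ∀ m, m ∈ P.points ↔ m ∈ H2C ∧ ∃ t₀ t₁ t₂ : ℝ, IsLift ![(t₀ : ℂ), t₁ * u, t₂] m

theorem isStdPlane_stdPlane {u : ℂ} (hu : ‖u‖ = 1) : IsStdPlane (stdPlane u hu) u :=
  fun _ => mem_stdPlane_points

theorem mem_geodesic_std {m : CP2} :
    m ∈ geodesic infty (heis 0 0) ↔ ∃ ρ : ℝ, 0 < ρ ∧ IsLift ![-(ρ : ℂ), 0, 1] m := by
  constructor
  · rintro ⟨v, w, hv, hw, hre, him, hm⟩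
    obtain ⟨c, hc, rfl⟩ := isLift_infty.exists_smul hv
    obtain ⟨d, hd, rfl⟩ := isLift_heis_zero.exists_smul hw
    have h : herm (c • ![1, 0, 0]) (d • ![0, 0, 1]) = c * conj d := by simp [herm]
    rw [h] at hre him
    have hdn := Complex.normSq_pos.2 hd
    refine ⟨-(c * conj d).re / Complex.normSq d, div_pos (neg_pos.2 hre) hdn, ?_⟩
    have h2 : c * conj d = ((c * conj d).re : ℝ) := Complex.ext (by simp) (by rw [him]; simp)
    convert hm.smul (inv_ne_zero hd) using 1
    have hd' : conj d ≠ 0 := by simpa using hd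
    ext i; fin_cases i
    · push_cast
      rw [← h2, ← Complex.mul_conj]
      simp; field_simp
    · simp
    · simp [hd]
  · rintro ⟨ρ, hρ, hm⟩
    refine ⟨(-(ρ : ℂ)) • ![1, 0, 0], ![0, 0, 1], isLift_infty.smul (by simp [hρ.ne']),
      isLift_heis_zero, ?_, ?_, ?_⟩
    · simp [herm, hρ]
    · simp [herm]
    · convert hm using 1
      ext i; fin_cases i <;> simp

theorem geodesic_subset_of_isStdPlane {P : RealPlane} {u : ℂ} (hP : IsStdPlane P u) :
    geodesic infty (heis 0 0) ⊆ P.points := by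
  intro m hm
  obtain ⟨ρ, hρ, h⟩ := mem_geodesic_std.1 hm
  refine (hP m).2 ⟨h.mem_H2C_iff.2 ?_, -ρ, 0, 1, ?_⟩
  · simp [herm]; linarith
  · convert h using 1
    simp

/-- If `z conj c` is real then `z` is a real multiple of `c`. -/
theorem exists_real_mul {z c : ℂ} (hc : c ≠ 0) (h : (z * conj c).im = 0) :
    ∃ r : ℝ, z = r * c := by
  refine ⟨(z * conj c).re / Complex.normSq c, ?_⟩
  have h2 : z * conj c = ((z * conj c).re : ℝ) := Complex.ext (by simp) (by rw [h]; simp)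
  have hc' : conj c ≠ 0 := by simpa using hc
  push_cast
  rw [← h2, ← Complex.mul_conj]
  field_simp

/-- Every real plane containing the geodesic from `∞` to `[0, 0]` is, up to a scalar, a standard
one. -/
theorem exists_isStdPlane {P : RealPlane} (hP : geodesic infty (heis 0 0) ⊆ P.points) :
    ∃ u : ℂ, ‖u‖ = 1 ∧ IsStdPlane P u := by
  have hpt : ∀ ρ : ℝ, 0 < ρ → ∃ c : ℂ, c ≠ 0 ∧ c • ![-(ρ : ℂ), 0, 1] ∈ P.lag := by
    intro ρ hρ
    have hne : (![-(ρ : ℂ), 0, 1] : C3) ≠ 0 := fun h => by simpa using congrFun h 2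
    obtain ⟨-, v, hv, hv'⟩ := hP (mem_geodesic_std.2 ⟨ρ, hρ, isLift_mk hne⟩)
    obtain ⟨c, hc, rfl⟩ := (isLift_mk hne).exists_smul hv'
    exact ⟨c, hc, hv⟩
  obtain ⟨c, hc, h1⟩ := hpt 1 one_pos
  obtain ⟨c', hc', h2⟩ := hpt 2 two_pos
  obtain ⟨r, rfl⟩ : ∃ r : ℝ, c' = r * c := by
    refine exists_real_mul hc ?_
    have := P.im_herm _ h2 _ h1
    have e : herm (c' • ![-((2 : ℝ) : ℂ), 0, 1]) (c • ![-((1 : ℝ) : ℂ), 0, 1])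
        = ((-3 : ℝ) : ℂ) * (c' * conj c) := by
      simp [herm]; ring
    rw [e, Complex.im_ofReal_mul] at this
    linarith
  have hr : (r : ℂ) ≠ 0 := left_ne_zero_of_mul hc'
  have he0 : c • ![1, 0, 0] ∈ P.lag := by
    convert P.lag.sub_mem h1 (P.lag.smul_mem r⁻¹ h2) using 1
    ext i; fin_cases i
    · simp; field_simp; ring
    · simp
    · simp; field_simp; ring
  have he2 : c • ![0, 0, 1] ∈ P.lag := by
    convert P.lag.add_mem h1 he0 using 1
    ext i; fin_cases i <;> simp
  have hcoord : ∀ v ∈ P.lag, (∃ s : ℝ, v 0 = s * c) ∧ ∃ s : ℝ, v 2 = s * c := by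
    intro v hv
    refine ⟨exists_real_mul hc ?_, exists_real_mul hc ?_⟩
    · simpa [herm] using P.im_herm v hv _ he2
    · simpa [herm] using P.im_herm v hv _ he0
  obtain ⟨w, hw, hw1⟩ : ∃ w ∈ P.lag, w 1 ≠ 0 := by
    by_contra! hcon
    have hle : P.lag ≤ Submodule.span ℝ (Set.range ![c • (![1, 0, 0] : C3), c • ![0, 0, 1]]) := by
      intro v hv
      obtain ⟨⟨s, hs⟩, t, ht⟩ := hcoord v hv
      have : v = s • (c • (![1, 0, 0] : C3)) + t • (c • (![0, 0, 1] : C3)) := by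
        ext i; fin_cases i
        · simp [hs]
        · simpa using hcon v hv
        · simp [ht]
      rw [this]
      exact Submodule.add_mem _
        (Submodule.smul_mem _ _ (Submodule.subset_span ⟨0, rfl⟩))
        (Submodule.smul_mem _ _ (Submodule.subset_span ⟨1, rfl⟩))
    have := (Submodule.finrank_mono hle).trans
      (finrank_range_le_card (R := ℝ) ![c • (![1, 0, 0] : C3), c • ![0, 0, 1]])
    rw [P.finrank_lag] at this
    simp at this
  have hwc : ‖w 1 / c‖ ≠ 0 := norm_ne_zero_iff.2 (div_ne_zero hw1 hc)
  have hwc' : (‖w 1 / c‖ : ℂ) ≠ 0 := by exact_mod_cast hwc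
  set u : ℂ := w 1 / c / ‖w 1 / c‖ with hu
  have hun : ‖u‖ = 1 := by
    rw [hu, norm_div, Complex.norm_real, norm_norm, div_self hwc]
  have hu0 : u ≠ 0 := by intro h; rw [h] at hun; simp at hun
  have he1 : c • ![0, u, 0] ∈ P.lag := by
    obtain ⟨⟨s, hs⟩, t, ht⟩ := hcoord w hw
    convert P.lag.smul_mem ‖w 1 / c‖⁻¹
      (P.lag.sub_mem hw (P.lag.add_mem (P.lag.smul_mem s he0)
        (P.lag.smul_mem t he2))) using 1
    ext i; fin_cases i
    · simp [hs, Matrix.vecHead]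
    · simp [hu, Matrix.vecHead, Matrix.vecTail]; field_simp
    · simp [ht, Matrix.vecHead, Matrix.vecTail]
  refine ⟨u, hun, fun m => and_congr_right fun _ => ⟨?_, ?_⟩⟩
  · rintro ⟨v, hv, hvm⟩
    obtain ⟨⟨s, hs⟩, t, ht⟩ := hcoord v hv
    obtain ⟨q, hq⟩ : ∃ q : ℝ, v 1 = q * (c * u) := by
      refine exists_real_mul (mul_ne_zero hc hu0) ?_
      simpa [herm] using P.im_herm v hv _ he1
    refine ⟨s, q, t, ?_⟩
    convert hvm.smul (inv_ne_zero hc) using 1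
    ext i; fin_cases i
    · simp [hs]; field_simp
    · simp [hq]; field_simp
    · simp [ht]; field_simp
  · rintro ⟨s, q, t, h⟩
    refine ⟨_, ?_, h.smul hc⟩
    convert P.lag.add_mem (P.lag.add_mem (P.lag.smul_mem s he0) (P.lag.smul_mem q he1))
      (P.lag.smul_mem t he2) using 1
    ext i; fin_cases i
    · simp; ring
    · simp; ring
    · simp; ring

/-- First order condition at a minimum of the distance function, along the line `X + ε h`. -/
theorem re_eq_zero_of_min {A H : ℂ} {ρ κ : ℝ} (hρ : 0 < ρ) (hκ : 0 ≤ κ)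
    (h : ∀ ε : ℝ, ε ^ 2 * κ < 2 * ρ →
      ‖A‖ ^ 2 * (2 * ρ - ε ^ 2 * κ) ≤ ‖A + ε * H‖ ^ 2 * (2 * ρ)) : (A * conj H).re = 0 := by
  by_contra hR
  set R := (A * conj H).re with hRdef
  set M := ‖H‖ ^ 2 * (2 * ρ) + ‖A‖ ^ 2 * κ with hM
  have hM0 : 0 ≤ M := by positivity
  have hexp : ∀ ε : ℝ, ‖A + ε * H‖ ^ 2 = ‖A‖ ^ 2 + 2 * ε * R + ε ^ 2 * ‖H‖ ^ 2 := by
    intro ε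
    simp only [Complex.sq_norm, Complex.normSq_apply, hRdef]
    simp
    ring
  have hR2 : 0 < R ^ 2 := by positivity
  set K := ρ + M + R ^ 2 * κ with hK
  have hK0 : 0 < K := by positivity
  set δ := ρ / K with hδ
  have hδ0 : 0 < δ := by positivity
  have hδK : δ * K = ρ := by rw [hδ]; field_simp
  have hδ1 : δ ≤ 1 := by
    rw [hδ, div_le_one hK0, hK]
    have : 0 ≤ R ^ 2 * κ := by positivity
    linarith
  have hb1 : δ * M ≤ ρ := by
    rw [← hδK]; gcongr
    have : 0 ≤ R ^ 2 * κ := by positivity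
    linarith
  have hb2 : δ * (R ^ 2 * κ) ≤ ρ := by
    calc δ * (R ^ 2 * κ) ≤ δ * K := by gcongr; linarith
      _ = ρ := hδK
  have hb3 : (-(δ * R)) ^ 2 * κ < 2 * ρ := by
    have : (-(δ * R)) ^ 2 * κ = δ * (δ * (R ^ 2 * κ)) := by ring
    rw [this]
    have : δ * (δ * (R ^ 2 * κ)) ≤ 1 * ρ := by gcongr
    linarith
  have := h _ hb3
  rw [hexp] at this
  have h5 : 4 * ρ * (δ * R ^ 2) ≤ (δ * M) * (δ * R ^ 2) := by rw [hM]; nlinarith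
  have h6 : 4 * ρ ≤ δ * M := le_of_mul_le_mul_right h5 (by positivity)
  linarith

/-- If `m` projects to `x = [(-ρ, 0, 1)]`, then the derivative of the distance to `m` vanishes at `x` in
the two directions `(ρ, 0, 1)` and `(0, u, 0)` of the real plane. -/
theorem fibre_conditions {P : RealPlane} {u : ℂ} (hu : ‖u‖ = 1) (hP : IsStdPlane P u) {ρ : ℝ}
    (hρ : 0 < ρ) {x m : CP2} {v : C3} (hx : IsLift ![-(ρ : ℂ), 0, 1] x) (hm : m ∈ P.fibre x)
    (hv : IsLift v m) :
    ((v 0 - ρ * v 2) * conj (v 0 + ρ * v 2)).re = 0 ∧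
      ((v 0 - ρ * v 2) * conj (v 1 * conj u)).re = 0 := by
  obtain ⟨hmH, hxP, hmin⟩ := hm
  have hXX : herm ![-(ρ : ℂ), 0, 1] ![-(ρ : ℂ), 0, 1] = ((-2 * ρ : ℝ) : ℂ) := by
    simp [herm]; ring
  have huu : u * conj u = 1 := by rw [Complex.mul_conj, Complex.normSq_eq_norm_sq, hu]; simp
  have key : ∀ (s t κ : ℝ) (h : C3), h = ![(s * ρ : ℂ), t * u, s] → 0 ≤ κ → herm h h = κ →
      (herm v ![-(ρ : ℂ), 0, 1] * conj (herm v h)).re = 0 := by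
    intro s t κ h hh hκ hhh
    refine re_eq_zero_of_min hρ hκ fun ε hε => ?_
    have hXh : herm ![-(ρ : ℂ), 0, 1] h = 0 := by rw [hh]; simp [herm]; ring
    have hhX : herm h ![-(ρ : ℂ), 0, 1] = 0 := by rw [← conj_herm, hXh, map_zero]
    set Y : C3 := ![-(ρ : ℂ), 0, 1] + (ε : ℂ) • h with hY
    have hYY' : herm Y Y = ((-(2 * ρ - ε ^ 2 * κ) : ℝ) : ℂ) := by
      simp only [hY, herm_add_left, herm_add_right, herm_smul_left, herm_smul_right, hXX, hXh,
        hhX, hhh, Complex.conj_ofReal]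
      push_cast
      ring
    have hYY : (herm Y Y).re = -(2 * ρ - ε ^ 2 * κ) := by rw [hYY', Complex.ofReal_re]
    have hY0 : Y ≠ 0 := by
      intro h0
      rw [h0, herm_zero_left] at hYY
      simp at hYY
      linarith
    have hyH : Projectivization.mk ℂ Y hY0 ∈ H2C := by
      rw [(isLift_mk hY0).mem_H2C_iff, hYY]; linarith
    have hyP : Projectivization.mk ℂ Y hY0 ∈ P.points := by
      refine (hP _).2 ⟨hyH, -ρ + ε * (s * ρ), ε * t, 1 + ε * s, ?_⟩
      convert isLift_mk hY0 using 1
      rw [hY, hh]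
      ext i; fin_cases i
      · simp
      · simp; ring
      · simp
    have := (hdist_le_hdist_iff hv hx (isLift_mk hY0) hmH ((hP x).1 hxP).1 hyH).1 (hmin _ hyP)
    rw [hYY, hXX, Complex.ofReal_re] at this
    have e : herm v Y = herm v ![-(ρ : ℂ), 0, 1] + ε * herm v h := by
      rw [hY, herm_add_right, herm_smul_right, Complex.conj_ofReal]
    rw [e] at this
    convert this using 2 <;> ring
  have h1 := key 1 0 (2 * ρ) ![(ρ : ℂ), 0, 1] (by simp) (by positivity) (by simp [herm]; ring)
  have h2 := key 0 1 1 ![0, u, 0] (by simp) zero_le_one (by simp [herm, huu])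
  have e0 : herm v ![-(ρ : ℂ), 0, 1] = v 0 - ρ * v 2 := by simp [herm]; ring
  have e1 : herm v ![(ρ : ℂ), 0, 1] = v 0 + ρ * v 2 := by simp [herm]; ring
  have e2 : herm v ![0, u, 0] = v 1 * conj u := by simp [herm]
  rw [e0, e1] at h1
  rw [e0, e2] at h2
  exact ⟨h1, h2⟩

theorem sub_ne_zero_of_neg {v : C3} {ρ : ℝ} (hρ : 0 < ρ) (hneg : (herm v v).re < 0) :
    v 0 - ρ * v 2 ≠ 0 := by
  intro h
  rw [herm_self_re, sub_eq_zero.1 h, mul_assoc, Complex.mul_conj] at hneg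
  norm_cast at hneg
  have := Complex.normSq_nonneg (v 2)
  nlinarith [sq_nonneg ‖v 1‖, mul_nonneg hρ.le this]

/-- Eliminating the base point `ρ` from the fibre conditions gives an equation of the whole spinal
surface. -/
theorem isNonneg_of_fibre_conditions {u : ℂ} {ρ : ℝ} (hρ : 0 < ρ) {v : C3}
    (hneg : (herm v v).re < 0) (h1 : ((v 0 - ρ * v 2) * conj (v 0 + ρ * v 2)).re = 0)
    (h2 : ((v 0 - ρ * v 2) * conj (v 1 * conj u)).re = 0) :
    IsNonneg (conj u ^ 2 * v 1 ^ 2 * conj (v 0 * v 2)) := by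
  have hA := sub_ne_zero_of_neg hρ hneg
  have hv02 : (v 0 * conj (v 2)).re < 0 := by
    rw [herm_self_re] at hneg; nlinarith [sq_nonneg ‖v 1‖]
  have h1' : v 0 * conj (v 0) = ρ ^ 2 * (v 2 * conj (v 2)) := by
    apply Complex.ext
    · simp [pow_two] at h1 ⊢; linarith
    · simp [pow_two]; ring
  set A := v 0 - ρ * v 2 with hAdef
  set T := A * conj (v 1 * conj u) with hT
  have hTT : conj T = -T := by
    apply Complex.ext
    · simp [h2]
    · simp
  have hTT2 : IsNonneg (T * conj T) := isNonneg_mul_conj T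
  have hneg2 : IsNonneg (-(A ^ 2 * conj (v 0 * v 2))) := by
    have : -(A ^ 2 * conj (v 0 * v 2)) = ((ρ ^ 2 * Complex.normSq (v 2) *
        (-2 * (v 0 * conj (v 2)).re) + 2 * ρ * Complex.normSq (v 0 * v 2) : ℝ) : ℂ) := by
      have hre : v 0 * conj (v 2) + v 2 * conj (v 0) = ((2 * (v 0 * conj (v 2)).re : ℝ) : ℂ) := by
        rw [← Complex.add_conj]; simp [mul_comm]
      push_cast at hre ⊢
      rw [← Complex.mul_conj, ← Complex.mul_conj]
      simp only [hAdef, map_mul]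
      linear_combination (-v 0 * conj (v 2)) * h1' - ρ ^ 2 * (v 2 * conj (v 2)) * hre
    rw [this]
    have := Complex.normSq_nonneg (v 2)
    have := Complex.normSq_nonneg (v 0 * v 2)
    have : 0 ≤ -2 * (v 0 * conj (v 2)).re := by linarith
    exact isNonneg_ofReal (by positivity)
  have hE := ((hTT2.mul hneg2).mul ((isNonneg_mul_conj A⁻¹).mul (isNonneg_mul_conj A⁻¹)))
  convert hE using 1
  have hA' : conj A ≠ 0 := by simpa using hA
  have hT1 : conj T = conj A * (v 1 * conj u) := by rw [hT]; simp
  have : T * conj T = -(conj A * (v 1 * conj u)) ^ 2 := by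
    rw [← hT1]; linear_combination conj T * hTT
  rw [this, map_inv₀]
  field_simp

/-! ### Splitting surfaces in standard position -/


/-- The fibres of the orthogonal projection onto a standard plane, over points of the geodesic, are the
orthogonal real planes. -/
theorem fibre_eq_stdMirror {P : RealPlane} {u : ℂ} (hu : ‖u‖ = 1) (hP : IsStdPlane P u) {ρ : ℝ}
    (hρ : 0 < ρ) {x : CP2} (hx : IsLift ![-(ρ : ℂ), 0, 1] x) :
    P.fibre x = (stdMirror u hu ρ hρ).points := by
  have huu : u * conj u = 1 := by rw [Complex.mul_conj, Complex.normSq_eq_norm_sq, hu]; simp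
  have hρ0 : (ρ : ℂ) ≠ 0 := by exact_mod_cast hρ.ne'
  have hXX : (herm ![-(ρ : ℂ), 0, 1] ![-(ρ : ℂ), 0, 1]).re = -2 * ρ := by
    simp [herm]; ring
  have hxP : x ∈ P.points :=
    geodesic_subset_of_isStdPlane hP (mem_geodesic_std.2 ⟨ρ, hρ, hx⟩)
  ext m
  rw [mem_stdMirror_points]
  constructor
  · intro hm
    obtain ⟨h1, h2⟩ := fibre_conditions hu hP hρ hx hm (isLift_rep m)
    have hA := sub_ne_zero_of_neg hρ ((isLift_rep m).mem_H2C_iff.1 hm.1)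
    refine ⟨hm.1, ?_⟩
    have hv := isLift_rep m
    set v := m.rep
    have h1' : v 0 * conj (v 0) = ρ ^ 2 * (v 2 * conj (v 2)) := by
      apply Complex.ext
      · simp [pow_two] at h1 ⊢; linarith
      · simp [pow_two]; ring
    set A := v 0 - ρ * v 2 with hAdef
    -- the multiple of `v` fixed by the symmetry
    have hl : Complex.I * conj A ≠ 0 := mul_ne_zero Complex.I_ne_zero (by simpa using hA)
    have hre : Complex.I * conj A * v 1 * conj u
        = ((Complex.I * conj A * v 1 * conj u).re : ℝ) := by
      apply Complex.ext
      · simp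
      · rw [Complex.ofReal_im, mul_assoc, mul_assoc, Complex.I_mul_im]
        rw [← h2, ← Complex.conj_re, map_mul, Complex.conj_conj]
    refine ⟨Complex.I * conj A * v 0, (Complex.I * conj A * v 1 * conj u).re, ?_⟩
    rw [← hre]
    convert hv.smul hl using 1
    ext i; fin_cases i
    · simp
    · simp; linear_combination (Complex.I * conj A * v 1) * huu
    · simp [hAdef]; field_simp
      linear_combination -h1'
  · rintro ⟨hmH, w, s, hm⟩
    refine ⟨hmH, hxP, fun y hy => ?_⟩
    obtain ⟨hyH, t₀, t₁, t₂, hy⟩ := (hP y).1 hy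
    rw [hdist_le_hdist_iff hm hx hy hmH ((hP x).1 hxP).1 hyH, hXX]
    have e1 : herm ![w, s * u, conj w / ρ] ![-(ρ : ℂ), 0, 1] = ((2 * w.im : ℝ) : ℂ) * Complex.I := by
      have := Complex.sub_conj w
      simp [herm] at this ⊢
      rw [← this]; field_simp; ring
    have e2 : herm ![w, s * u, conj w / ρ] ![(t₀ : ℂ), t₁ * u, t₂]
        = ((w.re * (t₂ + t₀ / ρ) + s * t₁ : ℝ) : ℂ)
          + ((w.im * (t₂ - t₀ / ρ) : ℝ) : ℂ) * Complex.I := by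
      have h1 := Complex.re_add_im w
      have h2 : conj w = w.re - w.im * Complex.I := by
        apply Complex.ext <;> simp
      simp [herm]
      rw [h2]
      linear_combination (-t₂ : ℂ) * h1 + (s * t₁ : ℂ) * huu
    have e3 : (herm ![(t₀ : ℂ), t₁ * u, t₂] ![(t₀ : ℂ), t₁ * u, t₂]).re = 2 * t₀ * t₂ + t₁ ^ 2 := by
      rw [herm_self_re]; simp [hu]; ring
    have hn : ∀ a b : ℝ, ‖(a : ℂ) + (b : ℂ) * Complex.I‖ ^ 2 = a ^ 2 + b ^ 2 := fun a b => by
      rw [Complex.sq_norm, Complex.normSq_add_mul_I]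
    have e4 : ‖((2 * w.im : ℝ) : ℂ) * Complex.I‖ ^ 2 = (2 * w.im) ^ 2 := by
      have := hn 0 (2 * w.im)
      rw [Complex.ofReal_zero, zero_add] at this
      rw [this]; ring
    rw [e1, e2, e3, e4, hn]
    obtain ⟨r, rfl⟩ : ∃ r : ℝ, t₀ = r * ρ := ⟨t₀ / ρ, by field_simp⟩
    rw [mul_div_cancel_right₀ _ hρ.ne']
    have k1 : 0 ≤ (w.re * (t₂ + r) + s * t₁) ^ 2 * ρ := by positivity
    have k2 : 0 ≤ w.im ^ 2 * (t₂ + r) ^ 2 * ρ := by positivity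
    have k3 : 0 ≤ w.im ^ 2 * t₁ ^ 2 := by positivity
    nlinarith

theorem exists_sq_eq_of_norm {ω : ℂ} (hω : ‖ω‖ = 1) : ∃ u : ℂ, ‖u‖ = 1 ∧ u ^ 2 = ω := by
  obtain ⟨u, hu⟩ := IsAlgClosed.exists_pow_nat_eq ω two_pos
  refine ⟨u, ?_, hu⟩
  have : ‖u‖ ^ 2 = 1 := by rw [← norm_pow, hu, hω]
  exact (pow_eq_one_iff_of_nonneg (norm_nonneg _) two_ne_zero).1 this

theorem exists_isSplittingSurface_std {z : ℂ} (hz : z ≠ 0) :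
    ∃ S, IsSplittingSurface infty (heis (-1) 0) (heis 0 0) (heis z 0) S := by
  have hρ : 0 < ‖z‖ := norm_pos_iff.2 hz
  have hρ0 : (‖z‖ : ℂ) ≠ 0 := by exact_mod_cast hρ.ne'
  obtain ⟨u, hu, huz⟩ := exists_sq_eq_of_norm (ω := z / ‖z‖)
    (by rw [norm_div, Complex.norm_real, norm_norm, div_self hρ.ne'])
  have hne : (![-(‖z‖ : ℂ), 0, 1] : C3) ≠ 0 := fun h => by simpa using congrFun h 2
  refine ⟨_, stdPlane u hu, stdMirror u hu ‖z‖ hρ,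
    geodesic_subset_of_isStdPlane (isStdPlane_stdPlane hu), rfl,
    ⟨stdMirror_symmMaps_infty, stdMirror_symmMaps_heis (by rw [huz]; field_simp)⟩,
    _, mem_geodesic_std.2 ⟨_, hρ, isLift_mk hne⟩,
    fibre_eq_stdMirror hu (isStdPlane_stdPlane hu) hρ (isLift_mk hne)⟩

/-- The symmetry about a real plane is antiunitary. -/
theorem herm_symm_eq {Q : RealPlane} {x y x' y' : C3} (hx : x ∈ Q.lag) (hy : y ∈ Q.lag)
    (hx' : x' ∈ Q.lag) (hy' : y' ∈ Q.lag) :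
    herm (x - Complex.I • y) (x' - Complex.I • y')
      = conj (herm (x + Complex.I • y) (x' + Complex.I • y')) := by
  have hreal : ∀ v ∈ Q.lag, ∀ w ∈ Q.lag, conj (herm v w) = herm v w := fun v hv w hw =>
    Complex.conj_eq_iff_im.2 (Q.im_herm v hv w hw)
  simp only [herm_add_left, herm_add_right, herm_sub_left, herm_sub_right, herm_smul_left,
    herm_smul_right, map_add, map_mul, Complex.conj_I, map_neg, hreal _ hx _ hx',
    hreal _ hx _ hy', hreal _ hy _ hx', hreal _ hy _ hy']
  ring

/-- The argument of `v₁² conj (v₀ v₂)` is that of `z` on the mirror of the symmetry of the reference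
pair with invariant `z`. -/
theorem mirror_equation {Q : RealPlane} {z : ℂ}
    (hQ : IsMirrorOfPair infty (heis (-1) 0) (heis 0 0) (heis z 0) Q) :
    ∃ κ : ℝ, 0 < κ ∧ ∀ v ∈ Q.lag,
      v 1 ^ 2 * conj (v 0 * v 2) = κ * (v 0 * conj (v 0)) * (v 1 * conj (v 1)) * z := by
  obtain ⟨⟨x, hx, y, hy, h1, h2⟩, x', hx', y', hy', h3, h4⟩ := hQ
  obtain ⟨α, hα, hxα⟩ := isLift_infty.exists_smul h1
  obtain ⟨β, hβ, hxβ⟩ := isLift_heis_zero.exists_smul h2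
  obtain ⟨l, hl, hxl⟩ := (isLift_heis (-1) 0).exists_smul h3
  obtain ⟨μ, hμ, hxμ⟩ := (isLift_heis z 0).exists_smul h4
  have hs0 : ((Real.sqrt 2 : ℝ) : ℂ) ≠ 0 := by
    exact_mod_cast (Real.sqrt_pos.2 two_pos).ne'
  have hα' : conj α ≠ 0 := by simpa using hα
  set s : ℝ := Real.sqrt 2
  -- compatibility of the scalars `α`, `β`, `l`, `μ`
  have c1 := herm_symm_eq hx' hy' hx hy
  have c2 := herm_symm_eq hx' hy' hx (Q.lag.neg_mem hy)
  rw [smul_neg, sub_neg_eq_add, ← sub_eq_add_neg] at c2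
  rw [hxα, hxβ, hxl, hxμ] at c1 c2
  simp [herm, heisLift] at c1 c2
  refine ⟨Complex.normSq β / Complex.normSq α, div_pos (Complex.normSq_pos.2 hβ)
    (Complex.normSq_pos.2 hα), fun v hv => ?_⟩
  have hsymm := fun (a b : C3) (ha : a ∈ Q.lag) (hb : b ∈ Q.lag) =>
    herm_symm_eq hv (Q.lag.zero_mem) ha hb
  simp only [smul_zero, sub_zero, add_zero] at hsymm
  have d1 := hsymm x y hx hy
  have d2 := hsymm x' y' hx' hy'
  rw [hxα, hxβ] at d1
  rw [hxl, hxμ] at d2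
  simp [herm, heisLift] at d1 d2
  have d1' := congrArg conj d1
  have d2' := congrArg conj d2
  simp at d1' d2'
  have key : conj α * v 1 = β * z * conj (v 1) := by
    refine mul_right_cancel₀ (mul_ne_zero (mul_ne_zero (mul_ne_zero hμ hs0) hα) hα') ?_
    linear_combination (-α * conj α * β) * d2' + (α * conj α * s * v 1) * c2
      + α * β * (conj (v 0) * c2 - conj l * d1')
      + conj α * β * (μ * ‖z‖ ^ 2 * d1 + v 0 * c1)
  push_cast
  rw [← Complex.mul_conj, ← Complex.mul_conj]
  field_simp
  simp only [map_mul]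
  linear_combination (v 1 * conj (v 0) * conj (v 2) * α) * key
    - (v 1 * conj (v 0) * β * z * conj (v 1)) * d1

theorem exists_neg_mem_mirror {Q : RealPlane} {z : ℂ}
    (hQ : IsMirrorOfPair infty (heis (-1) 0) (heis 0 0) (heis z 0) Q) :
    ∃ v ∈ Q.lag, (herm v v).re < 0 ∧ v 1 ≠ 0 := by
  obtain ⟨-, x, hx, y, hy, h3, -⟩ := hQ
  -- `x` and `y` cannot both have zero middle coordinate, since `[-1, 0]` does not
  obtain ⟨w, hw, hw1⟩ : ∃ w ∈ Q.lag, w 1 ≠ 0 := by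
    by_contra! hcon
    obtain ⟨c, hc, h⟩ := h3.exists_smul (isLift_heis (-1) 0)
    have := congrFun h 1
    simp [heisLift, hcon x hx, hcon y hy] at this
  obtain ⟨n, hn, hnn⟩ := Q.exists_neg
  by_cases hn1 : n 1 = 0
  · set a := (herm n n).re
    obtain ⟨N, hN⟩ : ∃ N : ℝ, N ^ 2 * a + 2 * N * (herm n w).re + (herm w w).re < 0 := by
      set b := |(herm n w).re|
      set c := |(herm w w).re|
      have hb : 0 ≤ b := abs_nonneg _
      have hc : 0 ≤ c := abs_nonneg _
      have hb' : (herm n w).re ≤ b := le_abs_self _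
      have hc' : (herm w w).re ≤ c := le_abs_self _
      have ha : 0 < -a := neg_pos.2 hnn
      set N := 1 + (2 * b + c) / (-a) with hNdef
      have hN1 : 1 ≤ N := by
        rw [hNdef]
        have : 0 ≤ (2 * b + c) / (-a) := by positivity
        linarith
      have hN2 : N * a = a - (2 * b + c) := by
        have := hnn.ne
        rw [hNdef, div_neg]; field_simp
        ring
      refine ⟨N, ?_⟩
      have e : N ^ 2 * a = N * (a - (2 * b + c)) := by rw [← hN2]; ring
      rw [e]
      nlinarith [mul_le_mul_of_nonneg_left hb' (by linarith : 0 ≤ N)]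
    refine ⟨N • n + w, Q.lag.add_mem (Q.lag.smul_mem N hn) hw, ?_, by simp [hn1, hw1]⟩
    have e : N • n = (N : ℂ) • n := by ext i; simp
    have hwn : (herm w n).re = (herm n w).re := by rw [← conj_herm, Complex.conj_re]
    rw [e]
    simp only [herm_add_left, herm_add_right, herm_smul_left, herm_smul_right, Complex.conj_ofReal,
      Complex.add_re, Complex.re_ofReal_mul, hwn]
    linarith
  · exact ⟨n, hn, hnn, hn1⟩

theorem ne_zero_of_neg {v : C3} (hv : (herm v v).re < 0) : v 0 ≠ 0 ∧ v 2 ≠ 0 := by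
  rw [herm_self_re] at hv
  constructor <;> intro h <;> rw [h] at hv <;> simp at hv <;> nlinarith [sq_nonneg ‖v 1‖]

/-- The reversed Cauchy–Schwarz inequality, written as the comparison of `d(v, v)` and `d(v, w)` in
`hdist_le_hdist_iff`. -/
theorem reverse_cauchy_schwarz {v : C3} (hv : (herm v v).re < 0) (w : C3) :
    ‖herm v v‖ ^ 2 * -(herm w w).re ≤ ‖herm v w‖ ^ 2 * -(herm v v).re := by
  set a := (herm v v).re with ha
  have hva : herm v v = (a : ℂ) := herm_self_eq v
  have hwv := conj_herm v w
  have hww := herm_self_eq w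
  set b := (herm w w).re
  -- the component of `w` orthogonal to `v` is positive or zero
  set f : C3 := (a : ℂ) • w - herm w v • v with hf
  have hfv : herm f v = 0 := by
    rw [hf, herm_sub_left, herm_smul_left, herm_smul_left, hva]; ring
  have hff : 0 ≤ (herm f f).re := by
    by_cases h : f = 0
    · simp [h, herm_zero_left]
    · exact (herm_self_pos_of_orthogonal hv hfv h).le
  have e : herm f f = ((a * (a * b - ‖herm v w‖ ^ 2) : ℝ) : ℂ) := by
    have : herm f f = a * herm f w := by
      have h : herm f f = herm f ((a : ℂ) • w - herm w v • v) := rfl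
      rw [h, herm_sub_right, herm_smul_right, herm_smul_right, hfv, Complex.conj_ofReal]; ring
    rw [this, hf, herm_sub_left, herm_smul_left, herm_smul_left, ← hwv, hww,
      mul_comm (conj _), Complex.mul_conj, Complex.normSq_eq_norm_sq]
    push_cast; ring
  rw [e, Complex.ofReal_re] at hff
  rw [hva, Complex.norm_real, Real.norm_eq_abs, sq_abs]
  have := nonpos_of_mul_nonneg_right hff hv
  nlinarith

/-- In standard position, a splitting surface contains the geodesic and is contained in the
hypersurface `conj ω v₁² conj (v₀ v₂) ∈ ℝ≥0`, where `ω = z / |z|`. -/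
theorem IsSplittingSurface.std {z ω : ℂ} (hz : z ≠ 0) (hω : ‖ω‖ = 1) (hzω : z = ‖z‖ * ω)
    {S : Set CP2} (hS : IsSplittingSurface infty (heis (-1) 0) (heis 0 0) (heis z 0) S) :
    geodesic infty (heis 0 0) ⊆ S ∧ S ⊆ H2C ∧
      ∀ m ∈ S, ∀ v, IsLift v m → IsNonneg (conj ω * v 1 ^ 2 * conj (v 0 * v 2)) := by
  obtain ⟨P, Q, hPγ, rfl, hQ, x, hx, hxQ⟩ := hS
  obtain ⟨u, hu, hP⟩ := exists_isStdPlane hPγ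
  have hfib : ∀ y ∈ geodesic infty (heis 0 0), ∀ m ∈ P.fibre y, ∀ v, IsLift v m →
      IsNonneg (conj u ^ 2 * v 1 ^ 2 * conj (v 0 * v 2)) := by
    intro y hy m hm v hv
    obtain ⟨ρ, hρ, hyl⟩ := mem_geodesic_std.1 hy
    obtain ⟨h1, h2⟩ := fibre_conditions hu hP hρ hyl hm hv
    exact isNonneg_of_fibre_conditions hρ (hv.mem_H2C_iff.1 hm.1) h1 h2
  -- a point of the mirror determines the direction of `P`
  have huω : conj u ^ 2 = conj ω := by
    obtain ⟨κ, hκ, hmir⟩ := mirror_equation hQ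
    obtain ⟨v, hvQ, hneg, hv1⟩ := exists_neg_mem_mirror hQ
    have hv0 := (ne_zero_of_neg hneg).1
    have hvne : v ≠ 0 := by rintro rfl; simp at hv1
    have hm : Projectivization.mk ℂ v hvne ∈ P.fibre x := by
      rw [hxQ]
      exact ⟨(isLift_mk hvne).mem_H2C_iff.2 hneg, v, hvQ, isLift_mk hvne⟩
    have h := hfib x hx _ hm v (isLift_mk hvne)
    rw [mul_assoc, hmir v hvQ, hzω, Complex.mul_conj, Complex.mul_conj] at h
    have hp0 := Complex.normSq_pos.2 hv0
    have hp1 := Complex.normSq_pos.2 hv1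
    have hzp := norm_pos_iff.2 hz
    have hr : 0 < κ * Complex.normSq (v 0) * Complex.normSq (v 1) * ‖z‖ := by positivity
    have h' : IsNonneg ((κ * Complex.normSq (v 0) * Complex.normSq (v 1) * ‖z‖ : ℝ)
        * (conj u ^ 2 * ω)) := by
      convert h using 1; push_cast; ring
    obtain ⟨h1, h2⟩ := h'
    rw [Complex.re_ofReal_mul] at h1
    rw [Complex.im_ofReal_mul] at h2
    have h3 := nonneg_of_mul_nonneg_right h1 hr
    have h4 := (mul_eq_zero.1 h2).resolve_left hr.ne'
    have h5 : ‖conj u ^ 2 * ω‖ = 1 := by simp [hu, hω]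
    have h6 : conj u ^ 2 * ω = ((conj u ^ 2 * ω).re : ℝ) :=
      Complex.ext (by simp) (by rw [h4]; simp)
    have h7 : conj u ^ 2 * ω = 1 := by
      rw [h6, Complex.norm_real, Real.norm_of_nonneg h3] at h5
      rw [h6, h5]; simp
    have hωω : ω * conj ω = 1 := by rw [Complex.mul_conj, Complex.normSq_eq_norm_sq, hω]; simp
    linear_combination conj ω * h7 - conj u ^ 2 * hωω
  refine ⟨fun m hm => ⟨m, hm, (hPγ hm).1, hPγ hm, fun y hy => ?_⟩, ?_, ?_⟩
  · have hmH := (hPγ hm).1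
    rw [hdist_le_hdist_iff (isLift_rep m) (isLift_rep m) (isLift_rep y) hmH hmH hy.1]
    have h1 := (isLift_rep m).mem_H2C_iff.1 hmH
    exact reverse_cauchy_schwarz h1 _
  · rintro m ⟨y, -, hm⟩
    exact hm.1
  · rintro m ⟨y, hy, hm⟩ v hv
    rw [← huω]
    exact hfib y hy m hm v hv

/-! ### Invariance under unitary maps -/


/-- The image of a real plane under a unitary map. -/
noncomputable def RealPlane.map (P : RealPlane) (A : C3 ≃ₗ[ℂ] C3) (hA : IsUnitary A) :
    RealPlane where
  lag := P.lag.map (A.restrictScalars ℝ : C3 →ₗ[ℝ] C3)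
  finrank_lag := by rw [LinearEquiv.finrank_map_eq, P.finrank_lag]
  im_herm := by
    rintro _ ⟨v, hv, rfl⟩ _ ⟨w, hw, rfl⟩
    exact (congrArg Complex.im (hA v w)).trans (P.im_herm v hv w hw)
  exists_neg := by
    obtain ⟨v, hv, hn⟩ := P.exists_neg
    exact ⟨A v, ⟨v, hv, rfl⟩, by rwa [hA]⟩

theorem act_mem_map_points {P : RealPlane} {A : C3 ≃ₗ[ℂ] C3} (hA : IsUnitary A) {m : CP2} :
    act A m ∈ (P.map A hA).points ↔ m ∈ P.points := by
  refine and_congr hA.act_mem_H2C_iff ⟨?_, ?_⟩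
  · rintro ⟨_, ⟨v, hv, rfl⟩, h⟩
    exact ⟨v, hv, (isLift_act_iff A).1 h⟩
  · rintro ⟨v, hv, h⟩
    exact ⟨A v, ⟨v, hv, rfl⟩, isLift_act h A⟩

theorem act_surjective (A : C3 ≃ₗ[ℂ] C3) : Function.Surjective (act A) :=
  fun m => ⟨_, act_act_symm A m⟩

theorem act_injective (A : C3 ≃ₗ[ℂ] C3) : Function.Injective (act A) :=
  Function.LeftInverse.injective (g := act A.symm) (act_symm_act A)

theorem hdist_act_le_iff {A : C3 ≃ₗ[ℂ] C3} (hA : IsUnitary A) {m x y : CP2} (hm : m ∈ H2C)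
    (hx : x ∈ H2C) (hy : y ∈ H2C) :
    hdist (act A m) (act A x) ≤ hdist (act A m) (act A y) ↔ hdist m x ≤ hdist m y := by
  rw [hdist_le_hdist_iff (isLift_act (isLift_rep m) A) (isLift_act (isLift_rep x) A)
    (isLift_act (isLift_rep y) A) (hA.act_mem_H2C_iff.2 hm) (hA.act_mem_H2C_iff.2 hx)
    (hA.act_mem_H2C_iff.2 hy), hdist_le_hdist_iff (isLift_rep m) (isLift_rep x) (isLift_rep y)
    hm hx hy, hA, hA, hA, hA]

theorem act_mem_map_fibre {P : RealPlane} {A : C3 ≃ₗ[ℂ] C3} (hA : IsUnitary A) {x m : CP2} :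
    act A m ∈ (P.map A hA).fibre (act A x) ↔ m ∈ P.fibre x := by
  constructor
  · rintro ⟨hm, hx, h⟩
    rw [hA.act_mem_H2C_iff] at hm
    rw [act_mem_map_points] at hx
    exact ⟨hm, hx, fun y hy =>
      (hdist_act_le_iff hA hm hx.1 hy.1).1 (h _ ((act_mem_map_points hA).2 hy))⟩
  · rintro ⟨hm, hx, h⟩
    refine ⟨hA.act_mem_H2C_iff.2 hm, (act_mem_map_points hA).2 hx, fun y hy => ?_⟩
    obtain ⟨y, rfl⟩ := act_surjective A y
    rw [act_mem_map_points] at hy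
    exact (hdist_act_le_iff hA hm hx.1 hy.1).2 (h y hy)

theorem act_mem_geodesic {A : C3 ≃ₗ[ℂ] C3} (hA : IsUnitary A) {a b m : CP2}
    (h : m ∈ geodesic a b) : act A m ∈ geodesic (act A a) (act A b) := by
  obtain ⟨v, w, hv, hw, h1, h2, hm⟩ := h
  exact ⟨A v, A w, isLift_act hv A, isLift_act hw A, by rwa [hA], by rwa [hA],
    by rw [← map_add]; exact isLift_act hm A⟩

theorem act_mem_geodesic_iff {A : C3 ≃ₗ[ℂ] C3} (hA : IsUnitary A) {a b m : CP2} :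
    act A m ∈ geodesic (act A a) (act A b) ↔ m ∈ geodesic a b := by
  refine ⟨fun h => ?_, act_mem_geodesic hA⟩
  have := act_mem_geodesic hA.symm h
  rwa [act_symm_act, act_symm_act, act_symm_act] at this

theorem RealPlane.SymmMaps.map {Q : RealPlane} {A : C3 ≃ₗ[ℂ] C3} (hA : IsUnitary A) {m n : CP2}
    (h : Q.SymmMaps m n) : (Q.map A hA).SymmMaps (act A m) (act A n) := by
  obtain ⟨x, hx, y, hy, h1, h2⟩ := h
  refine ⟨A x, ⟨x, hx, rfl⟩, A y, ⟨y, hy, rfl⟩, ?_, ?_⟩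
  · rw [← map_smul, ← map_add]; exact isLift_act h1 A
  · rw [← map_smul, ← map_sub]; exact isLift_act h2 A

theorem IsSplittingSurface.act {A : C3 ≃ₗ[ℂ] C3} (hA : IsUnitary A) {a b c d : CP2} {S : Set CP2}
    (h : IsSplittingSurface a b c d S) :
    IsSplittingSurface (act A a) (act A b) (act A c) (act A d) (act A '' S) := by
  obtain ⟨P, Q, hP, rfl, ⟨hQ1, hQ2⟩, x, hx, hxQ⟩ := h
  refine ⟨P.map A hA, Q.map A hA, ?_, ?_, ⟨hQ1.map hA, hQ2.map hA⟩, CHyp.act A x,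
    act_mem_geodesic hA hx, ?_⟩
  · intro m
    obtain ⟨m, rfl⟩ := act_surjective A m
    rw [act_mem_geodesic_iff hA, act_mem_map_points]
    exact fun h => hP h
  · ext m
    obtain ⟨m, rfl⟩ := act_surjective A m
    rw [(act_injective A).mem_set_image]
    constructor
    · rintro ⟨y, hy, hm⟩
      exact ⟨CHyp.act A y, act_mem_geodesic hA hy, (act_mem_map_fibre hA).2 hm⟩
    · rintro ⟨y, hy, hm⟩
      obtain ⟨y, rfl⟩ := act_surjective A y
      exact ⟨y, (act_mem_geodesic_iff hA).1 hy, (act_mem_map_fibre hA).1 hm⟩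
  · ext m
    obtain ⟨m, rfl⟩ := act_surjective A m
    rw [act_mem_map_fibre, act_mem_map_points, hxQ]

/-- `Spl` exists, contains the common geodesic and is contained in an explicit hypersurface, in
coordinates adapted to the pair of triangles. -/
theorem Spl_properties {a b c d : CP2} {z ω : ℂ} (hz : z ≠ 0) (hω : ‖ω‖ = 1) (hzω : z = ‖z‖ * ω)
    {A : C3 ≃ₗ[ℂ] C3} (hA : IsUnitary A) (ha : act A a = infty) (hb : act A b = heis (-1) 0)
    (hc : act A c = heis 0 0) (hd : act A d = heis z 0) :
    geodesic a c ⊆ Spl a b c d ∧ Spl a b c d ⊆ H2C ∧ ∀ m ∈ Spl a b c d, ∀ v, IsLift v m →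
      IsNonneg (conj ω * A v 1 ^ 2 * conj (A v 0 * A v 2)) := by
  have hex : ∃ S, IsSplittingSurface a b c d S := by
    obtain ⟨S, hS⟩ := exists_isSplittingSurface_std hz
    rw [← ha, ← hb, ← hc, ← hd] at hS
    have := hS.act hA.symm
    simp only [act_symm_act] at this
    exact ⟨_, this⟩
  have hS : IsSplittingSurface a b c d (Spl a b c d) := Classical.epsilon_spec hex
  have h := hS.act hA
  rw [ha, hb, hc, hd] at h
  obtain ⟨h1, h2, h3⟩ := h.std hz hω hzω
  rw [← ha, ← hc] at h1
  refine ⟨fun m hm => ?_, fun m hm => ?_, fun m hm v hv => ?_⟩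
  · exact (act_injective A).mem_set_image.1 (h1 (act_mem_geodesic hA hm))
  · exact hA.act_mem_H2C_iff.1 (h2 ⟨m, hm, rfl⟩)
  · exact h3 _ ⟨m, hm, rfl⟩ _ (isLift_act hv A)

/-! ### Comparison of the three splitting surfaces -/


theorem geodesic_comm (a b : CP2) : geodesic a b = geodesic b a := by
  have key : ∀ a b : CP2, geodesic a b ⊆ geodesic b a := by
    rintro a b m ⟨v, w, hv, hw, h1, h2, hm⟩
    refine ⟨w, v, hw, hv, ?_, ?_, by rwa [add_comm]⟩
    · rwa [← conj_herm, Complex.conj_re]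
    · rw [← conj_herm, Complex.conj_im, h2, neg_zero]
  exact (key a b).antisymm (key b a)

theorem continuous_mk' :
    Continuous (Projectivization.mk' ℂ : {v : C3 // v ≠ 0} → CP2) :=
  continuous_coinduced_rng

/-- The points `[v + t w]`, `t > 0`, of the geodesic tend to `[v]` as `t → 0`. -/
theorem left_mem_closure_geodesic {a b : CP2} {v w : C3} (hv : IsLift v a) (hw : IsLift w b)
    (hb : b ∈ boundary) (hvw : herm v w = -1) : a ∈ closure (geodesic a b) := by
  have hww := hw.mem_boundary_iff.1 hb
  have hne : ∀ t : ℝ, v + (t : ℂ) • w ≠ 0 := by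
    intro t h
    have : herm (v + (t : ℂ) • w) w = -1 := by
      rw [herm_add_left, herm_smul_left, hww, hvw]; simp
    rw [h, herm_zero_left] at this
    norm_num at this
  let g : ℝ → CP2 := fun t => Projectivization.mk' ℂ ⟨v + (t : ℂ) • w, hne t⟩
  have hg : Continuous g := by
    refine continuous_mk'.comp (Continuous.subtype_mk ?_ _)
    exact continuous_const.add (Complex.continuous_ofReal.smul continuous_const)
  have hg0 : g 0 = a := by
    have h : IsLift (v + ((0 : ℝ) : ℂ) • w) (g 0) := ⟨hne 0, rfl⟩
    simp only [Complex.ofReal_zero, zero_smul, add_zero] at h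
    exact h.unique hv
  have hlim : Filter.Tendsto g (nhdsWithin 0 (Set.Ioi 0)) (nhds a) := by
    rw [← hg0]
    exact (hg.tendsto 0).mono_left nhdsWithin_le_nhds
  refine mem_closure_of_tendsto hlim ?_
  filter_upwards [self_mem_nhdsWithin] with t ht
  have ht0 : 0 < t := ht
  refine ⟨v, (t : ℂ) • w, hv, hw.smul (by exact_mod_cast ht0.ne'), ?_, ?_, hne t, rfl⟩
  · rw [herm_smul_right, hvw]; simp [ht0]
  · rw [herm_smul_right, hvw]; simp

/-- The quartic function whose nonnegativity defines the splitting surface opposite to the first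
vertex, in terms of `X = ⟨v, u₀⟩`, `Y = ⟨v, u₁⟩`, `W = ⟨v, u₂⟩`. -/
noncomputable def splitFun (ω : ℂ) (u₀ u₁ u₂ v : C3) : ℂ :=
  -(conj ω * (herm v u₀ - herm v u₁ - herm v u₂) ^ 2 * conj (herm v u₁ * herm v u₂))

theorem splitFun_smul (ω : ℂ) (u₀ u₁ u₂ v : C3) (c : ℂ) :
    splitFun ω u₀ u₁ u₂ (c • v) = (c * conj c) * (c * conj c) * splitFun ω u₀ u₁ u₂ v := by
  simp only [splitFun, herm_smul_left, map_mul]; ring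

theorem splitFun_smul_frame (ω : ℂ) (u₀ u₁ u₂ v : C3) {c : ℂ} (hc : c * conj c = 1) :
    splitFun ω (c • u₀) (c • u₁) (c • u₂) v = splitFun ω u₀ u₁ u₂ v := by
  simp only [splitFun, herm_smul_right, map_mul, Complex.conj_conj]
  linear_combination (c * conj c + 1) * (-(conj ω * (herm v u₀ - herm v u₁ - herm v u₂) ^ 2 *
    (conj (herm v u₁) * conj (herm v u₂)))) * hc

/-- The condition is independent of the lift, as `splitFun` is homogeneous of bidegree `(2, 2)`. -/
theorem isClosed_splitFun (ω : ℂ) (u₀ u₁ u₂ : C3) :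
    IsClosed {m : CP2 | ∀ v, IsLift v m → IsNonneg (splitFun ω u₀ u₁ u₂ v)} := by
  have hc : ∀ u : C3, Continuous fun v : C3 => herm v u := fun u => by
    unfold herm; fun_prop
  have hF : Continuous (splitFun ω u₀ u₁ u₂) := by
    have h0 := hc u₀
    have h1 := hc u₁
    have h2 := hc u₂
    unfold splitFun
    exact ((continuous_const.mul (((h0.sub h1).sub h2).pow 2)).mul
      (Complex.continuous_conj.comp (h1.mul h2))).neg
  have hcl : IsClosed {z : ℂ | IsNonneg z} :=
    (isClosed_le continuous_const Complex.continuous_re).inter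
      (isClosed_eq Complex.continuous_im continuous_const)
  refine isClosed_coinduced.2 ?_
  have : (Projectivization.mk' ℂ : {v : C3 // v ≠ 0} → CP2) ⁻¹'
      {m : CP2 | ∀ v, IsLift v m → IsNonneg (splitFun ω u₀ u₁ u₂ v)}
      = (fun v : {v : C3 // v ≠ 0} => splitFun ω u₀ u₁ u₂ v) ⁻¹' {z : ℂ | IsNonneg z} := by
    ext ⟨v, hv⟩
    refine ⟨fun h => h v ⟨hv, rfl⟩, fun h w hw => ?_⟩
    obtain ⟨c, -, rfl⟩ := (isLift_mk hv).exists_smul hw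
    rw [splitFun_smul]
    exact ((isNonneg_mul_conj c).mul (isNonneg_mul_conj c)).mul h
  rw [this]
  exact hcl.preimage (hF.comp continuous_subtype_val)

/-- The mutual products of `u₀`, `u₁`, `u₂` are `-1`. The vectors are also null in the applications,
where they are lifts of the vertices of a real ideal triangle. -/
structure IsFrame (u₀ u₁ u₂ : C3) : Prop where
  h01 : herm u₀ u₁ = -1
  h12 : herm u₁ u₂ = -1
  h20 : herm u₂ u₀ = -1

theorem IsFrame.rotate {u₀ u₁ u₂ : C3} (h : IsFrame u₀ u₁ u₂) : IsFrame u₁ u₂ u₀ :=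
  ⟨h.h12, h.h20, h.h01⟩

/-- Two frames over the same points differ by a common unit scalar. -/
theorem IsFrame.exists_smul {u₀ u₁ u₂ w₀ w₁ w₂ : C3} (hu : IsFrame u₀ u₁ u₂)
    (hw : IsFrame w₀ w₁ w₂) {a b c : CP2} (hua : IsLift u₀ a) (hub : IsLift u₁ b)
    (huc : IsLift u₂ c) (hwa : IsLift w₀ a) (hwb : IsLift w₁ b) (hwc : IsLift w₂ c) :
    ∃ k : ℂ, k * conj k = 1 ∧ w₀ = k • u₀ ∧ w₁ = k • u₁ ∧ w₂ = k • u₂ := by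
  obtain ⟨r, hr, rfl⟩ := hua.exists_smul hwa
  obtain ⟨s, hs, rfl⟩ := hub.exists_smul hwb
  obtain ⟨t, ht, rfl⟩ := huc.exists_smul hwc
  obtain ⟨h1, h2, h3⟩ := hw
  simp only [herm_smul_left, herm_smul_right, hu.h01, hu.h12, hu.h20] at h1 h2 h3
  have h1' : r * conj s = 1 := by linear_combination -h1
  have h2' : s * conj t = 1 := by linear_combination -h2
  have h3' : t * conj r = 1 := by linear_combination -h3
  have h2'' := congrArg conj h2'
  simp at h2''
  have hs' : conj s ≠ 0 := by simpa using hs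
  have hrt : r = t := mul_right_cancel₀ hs' (by linear_combination h1' - h2'')
  subst hrt
  have h1'' := congrArg conj h1'
  simp at h1''
  have hr' : conj r ≠ 0 := by simpa using hr
  have hrs : s = r := mul_right_cancel₀ hr' (by linear_combination h1'' - h3')
  subst hrs
  exact ⟨_, h3', rfl, rfl, rfl⟩

/-- A frame over the vertices of a triangle in standard position, listed as `b`, `c`, `a` so that the
first vertex is opposite to the edge `ac`. -/
theorem exists_frame {a b c : CP2} {A : C3 ≃ₗ[ℂ] C3} (hA : IsUnitary A) (ha : act A a = infty)
    (hb : act A b = heis (-1) 0) (hc : act A c = heis 0 0) :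
    ∃ u₀ u₁ u₂ : C3, IsFrame u₀ u₁ u₂ ∧ IsLift u₀ b ∧ IsLift u₁ c ∧ IsLift u₂ a ∧
      ∀ v, herm v u₀ = A v 2 - A v 0 + (Real.sqrt 2 : ℝ) * A v 1 ∧ herm v u₁ = -A v 0 ∧
        herm v u₂ = A v 2 := by
  have hp : ∀ v x, herm v (A.symm x) = herm (A v) x := fun v x => by
    rw [← hA, A.apply_symm_apply]
  refine ⟨A.symm ((-1 : ℂ) • heisLift (-1) 0), A.symm ((-1 : ℂ) • ![0, 0, 1]), A.symm ![1, 0, 0],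
    ⟨?_, ?_, ?_⟩, ?_, ?_, ?_, fun v => ⟨?_, ?_, ?_⟩⟩
  · rw [hA.symm]; simp [herm, heisLift]
  · rw [hA.symm]; simp [herm]
  · rw [hA.symm]; simp [herm, heisLift]
  · rw [← isLift_act_iff A, hb, A.apply_symm_apply]
    exact (isLift_heis _ _).smul (by norm_num)
  · rw [← isLift_act_iff A, hc, A.apply_symm_apply]
    exact isLift_heis_zero.smul (by norm_num)
  · rw [← isLift_act_iff A, ha, A.apply_symm_apply]
    exact isLift_infty
  · rw [hp]; simp [herm, heisLift]; ring
  · rw [hp]; simp [herm]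
  · rw [hp]; simp [herm]

/-- The Hermitian form in terms of the products with a frame of null vectors. -/
theorem exists_frame_form {a b c : CP2} (h : IsRealIdealTriangle a b c) :
    ∃ u₀ u₁ u₂ : C3, IsFrame u₀ u₁ u₂ ∧ IsLift u₀ a ∧ IsLift u₁ b ∧ IsLift u₂ c ∧
      ∀ v, 2 * (herm v v).re = ‖herm v u₀‖ ^ 2 + ‖herm v u₁‖ ^ 2 + ‖herm v u₂‖ ^ 2
        - 2 * (herm v u₀ * conj (herm v u₁) + herm v u₁ * conj (herm v u₂)
          + herm v u₂ * conj (herm v u₀)).re := by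
  obtain ⟨A, hA, ha, hb, hc⟩ := exists_unitary_of_triangle h
  obtain ⟨u₀, u₁, u₂, hu, h0, h1, h2, hX⟩ := exists_frame hA ha hb hc
  refine ⟨u₂, u₀, u₁, hu.rotate.rotate, h2, h0, h1, fun v => ?_⟩
  obtain ⟨e0, e1, e2⟩ := hX v
  have hs2 : Real.sqrt 2 * Real.sqrt 2 = 2 := Real.mul_self_sqrt zero_le_two
  rw [e0, e1, e2, ← hA, herm_self_re]
  simp only [Complex.sq_norm, Complex.normSq_apply]
  simp
  linear_combination (-((A v 1).re ^ 2 + (A v 1).im ^ 2)) * hs2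

/-- The splitting surface of the edge `ac` in the coordinates given by any frame over `τ`. These
coordinates do not depend on the edge, which allows to compare the three surfaces. -/
theorem Spl_subset {a b c d : CP2} (h : IsRealIdealTriangle a b c)
    (h' : IsRealIdealTriangle a c d) {ω : ℂ} (hω : ‖ω‖ = 1) (hZ : Z a b c d = ‖Z a b c d‖ * ω)
    {u₀ u₁ u₂ : C3} (hu : IsFrame u₀ u₁ u₂) (h0 : IsLift u₀ b) (h1 : IsLift u₁ c)
    (h2 : IsLift u₂ a) :
    geodesic a c ⊆ Spl a b c d ∧ Spl a b c d ⊆ H2C ∧ ∀ m ∈ Spl a b c d, ∀ v, IsLift v m →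
      IsNonneg (splitFun ω u₀ u₁ u₂ v) := by
  obtain ⟨A, hA, ha, hb, hc, hd⟩ : HasInvariant a b c d (Z a b c d) :=
    Classical.epsilon_spec (exists_hasInvariant h h')
  have hz : Z a b c d ≠ 0 := by
    intro hz
    rw [hz, ← hc] at hd
    exact h'.2.1 (act_injective A hd).symm
  obtain ⟨k1, k2, k3⟩ := Spl_properties hz hω hZ hA ha hb hc hd
  refine ⟨k1, k2, fun m hm v hv => ?_⟩
  obtain ⟨w₀, w₁, w₂, hw, l0, l1, l2, hX⟩ := exists_frame hA ha hb hc
  obtain ⟨k, hk, rfl, rfl, rfl⟩ := hu.exists_smul hw h0 h1 h2 l0 l1 l2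
  rw [← splitFun_smul_frame ω u₀ u₁ u₂ v hk]
  obtain ⟨e0, e1, e2⟩ := hX v
  have hs2 : ((Real.sqrt 2 : ℝ) : ℂ) * (Real.sqrt 2 : ℝ) = 2 := by
    exact_mod_cast Real.mul_self_sqrt zero_le_two
  convert (isNonneg_ofReal zero_le_two).mul (k3 m hm v hv) using 1
  simp only [splitFun, e0, e1, e2, map_mul, map_neg, Complex.ofReal_ofNat]
  linear_combination (conj ω * A v 1 ^ 2 * conj (A v 0) * conj (A v 2)) * hs2

theorem eq_vertex_of_splitFun {u₀ u₁ u₂ v : C3} {ω : ℂ} (hω : ‖ω‖ = 1) (hre : 0 ≤ ω.re)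
    (hform : 2 * (herm v v).re = ‖herm v u₀‖ ^ 2 + ‖herm v u₁‖ ^ 2 + ‖herm v u₂‖ ^ 2
        - 2 * (herm v u₀ * conj (herm v u₁) + herm v u₁ * conj (herm v u₂)
          + herm v u₂ * conj (herm v u₀)).re)
    (hv : (herm v v).re ≤ 0) (h0 : IsNonneg (splitFun ω u₀ u₁ u₂ v))
    (h1 : IsNonneg (splitFun ω u₁ u₂ u₀ v)) : herm v u₂ = 0 := by
  refine eq_zero_of_splitting hω hre ?_ h0 h1
  simp only [Complex.sq_norm, Complex.normSq_apply] at hform ⊢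
  simp at hform ⊢
  linarith

/-- Two surfaces containing consecutive edges and contained in the corresponding hypersurfaces meet only
at the common vertex. -/
theorem closureBar_inter {u₀ u₁ u₂ : C3} {p₀ p₁ p₂ : CP2} {ω : ℂ} (hω : ‖ω‖ = 1)
    (hre : 0 ≤ ω.re) (hu : IsFrame u₀ u₁ u₂) (hl0 : IsLift u₀ p₀) (hl1 : IsLift u₁ p₁)
    (hl2 : IsLift u₂ p₂) (hb0 : p₀ ∈ boundary) (hb1 : p₁ ∈ boundary) (hb2 : p₂ ∈ boundary)
    (hform : ∀ v, 2 * (herm v v).re = ‖herm v u₀‖ ^ 2 + ‖herm v u₁‖ ^ 2 + ‖herm v u₂‖ ^ 2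
        - 2 * (herm v u₀ * conj (herm v u₁) + herm v u₁ * conj (herm v u₂)
          + herm v u₂ * conj (herm v u₀)).re) {S T : Set CP2}
    (hS : geodesic p₂ p₁ ⊆ S) (hSH : S ⊆ H2C)
    (hS' : ∀ m ∈ S, ∀ v, IsLift v m → IsNonneg (splitFun ω u₀ u₁ u₂ v))
    (hT : geodesic p₀ p₂ ⊆ T)
    (hT' : ∀ m ∈ T, ∀ v, IsLift v m → IsNonneg (splitFun ω u₁ u₂ u₀ v)) :
    S ∩ T = ∅ ∧ closureBar S ∩ closureBar T = {p₂} := by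
  have h22 := hl2.mem_boundary_iff.1 hb2
  constructor
  · ext m
    simp only [Set.mem_inter_iff, Set.mem_empty_iff_false, iff_false, not_and]
    intro hmS hmT
    have hl := isLift_rep m
    have hneg := hl.mem_H2C_iff.1 (hSH hmS)
    have h := eq_vertex_of_splitFun hω hre (hform _) hneg.le (hS' m hmS _ hl) (hT' m hmT _ hl)
    refine herm_ne_zero_of_neg hneg hl2.ne_zero (by simp [h22]) ?_
    rw [← conj_herm, h, map_zero]
  · ext m
    constructor
    · rintro ⟨⟨hmS, hm⟩, hmT, -⟩
      have hl := isLift_rep m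
      have k0 := closure_minimal hS' (isClosed_splitFun ω u₀ u₁ u₂) hmS _ hl
      have k1 := closure_minimal hT' (isClosed_splitFun ω u₁ u₂ u₀) hmT _ hl
      have hle : (herm m.rep m.rep).re ≤ 0 := by
        rcases hm with hm | hm
        · exact (hl.mem_H2C_iff.1 hm).le
        · simp [hl.mem_boundary_iff.1 hm]
      have h := eq_vertex_of_splitFun hω hre (hform _) hle k0 k1
      have h' : herm u₂ m.rep = 0 := by rw [← conj_herm, h, map_zero]
      rcases hm with hm | hm
      · exact absurd h' (herm_ne_zero_of_neg (hl.mem_H2C_iff.1 hm) hl2.ne_zero (by simp [h22]))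
      · obtain ⟨k, -, hk⟩ := exists_smul_eq_of_null hl2.ne_zero hl.ne_zero h22
          (hl.mem_boundary_iff.1 hm) h'
        exact (hl2.eq_of_smul hl hk).symm
    · rintro rfl
      have h21 : herm u₂ u₁ = -1 := by rw [← conj_herm, hu.h12]; simp
      refine ⟨⟨closure_mono hS (left_mem_closure_geodesic hl2 hl1 hb1 h21), Or.inr hb2⟩,
        closure_mono hT ?_, Or.inr hb2⟩
      rw [geodesic_comm]
      exact left_mem_closure_geodesic hl2 hl0 hb0 hu.h20

/-- The frame of `exists_frame_form`, indexed cyclically. -/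
theorem exists_cyclic_frame {p : Fin 3 → CP2} (hτ : IsRealIdealTriangle (p 0) (p 1) (p 2)) :
    ∃ u : Fin 3 → C3,
      (∀ i, IsFrame (u i) (u (i + 1)) (u (i + 2))) ∧ (∀ i, IsLift (u i) (p i)) ∧
      ∀ i v, 2 * (herm v v).re
        = ‖herm v (u i)‖ ^ 2 + ‖herm v (u (i + 1))‖ ^ 2 + ‖herm v (u (i + 2))‖ ^ 2
        - 2 * (herm v (u i) * conj (herm v (u (i + 1)))
          + herm v (u (i + 1)) * conj (herm v (u (i + 2)))
          + herm v (u (i + 2)) * conj (herm v (u i))).re := by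
  obtain ⟨u₀, u₁, u₂, hu, h0, h1, h2, hf⟩ := exists_frame_form hτ
  refine ⟨![u₀, u₁, u₂], fun i => ?_, fun i => ?_, fun i v => ?_⟩
  · fin_cases i
    · exact hu
    · exact hu.rotate
    · exact hu.rotate.rotate
  · fin_cases i
    · exact h0
    · exact h1
    · exact h2
  · rw [hf v]
    fin_cases i <;> simp [Fin.add_def] <;> ring

theorem IsRealIdealTriangle.rotate {a b c : CP2} (h : IsRealIdealTriangle a b c) :
    IsRealIdealTriangle b c a := by
  obtain ⟨h1, h2, h3, P, ha, hb, hc⟩ := h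
  exact ⟨h2, h3.symm, h1.symm, P, hb, hc, ha⟩

end CHyp

open CHyp in
theorem theorem4 (p q : Fin 3 → CHyp.CP2) (θ : ℝ)
    (hτ : CHyp.IsRealIdealTriangle (p 0) (p 1) (p 2))
    (hτi : ∀ i : Fin 3, CHyp.IsRealIdealTriangle (p (i + 2)) (p (i + 1)) (q i))
    (hθ : θ ∈ Set.Icc (-(Real.pi / 2)) (Real.pi / 2))
    (harg : ∀ i : Fin 3, (CHyp.Z (p (i + 2)) (p i) (p (i + 1)) (q i)).arg = θ)
    (S : Fin 3 → Set CHyp.CP2)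
    (hS : ∀ i : Fin 3, S i = CHyp.Spl (p (i + 2)) (p i) (p (i + 1)) (q i)) :
    ∀ i : Fin 3, S i ∩ S (i + 1) = ∅ ∧
      CHyp.closureBar (S i) ∩ CHyp.closureBar (S (i + 1)) = {p (i + 2)} := by
  have hω : ‖Complex.exp (θ * Complex.I)‖ = 1 := Complex.norm_exp_ofReal_mul_I θ
  have hre : 0 ≤ (Complex.exp (θ * Complex.I)).re := by
    rw [Complex.exp_ofReal_mul_I_re]
    exact Real.cos_nonneg_of_mem_Icc hθ
  have hZ : ∀ i, Z (p (i + 2)) (p i) (p (i + 1)) (q i)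
      = ‖Z (p (i + 2)) (p i) (p (i + 1)) (q i)‖ * Complex.exp (θ * Complex.I) := fun i => by
    conv_lhs => rw [← Complex.norm_mul_exp_arg_mul_I (Z (p (i + 2)) (p i) (p (i + 1)) (q i)),
      harg i]
  have htri : ∀ i : Fin 3, IsRealIdealTriangle (p (i + 2)) (p i) (p (i + 1)) := by
    intro i
    fin_cases i
    · exact hτ.rotate.rotate
    · exact hτ
    · exact hτ.rotate
  have hbd : ∀ i, p i ∈ boundary := fun i => by
    obtain ⟨-, -, -, P, -, h, -⟩ := htri i
    exact h.1
  obtain ⟨u, hfr, hl, hform⟩ := exists_cyclic_frame hτ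
  have hprop := fun i => Spl_subset (htri i) (hτi i) hω (hZ i) (hfr i) (hl i) (hl (i + 1))
    (hl (i + 2))
  simp only [← hS] at hprop
  intro i
  have e1 : i + 1 + 1 = i + 2 := by rw [add_assoc]; rfl
  have e2 : i + 1 + 2 = i := by rw [add_assoc]; exact add_zero i
  obtain ⟨hS1, hS2, hS3⟩ := hprop i
  obtain ⟨hT1, -, hT3⟩ := hprop (i + 1)
  rw [e1, e2] at hT1 hT3
  exact closureBar_inter hω hre (hfr i) (hl i) (hl (i + 1)) (hl (i + 2)) (hbd i) (hbd (i + 1))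
    (hbd (i + 2)) (hform i) hS1 hS2 hS3 hT1 hT3
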